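/- A high degree vertex (HDV) of a finite simple graph is a vertex of degree at least $3$. A tree is called linear if all of its HDVs lie on a single induced path, and $k$-linear if moreover it has exactly $k$ HDVs. Let $a_{n,k}$ be the number of isomorphism classes of $k$-linear trees on $n$ vertices, and let $P(x)=\sum_{n\ge 0}p(n)x^n$, where $p(n)$ is the number of partitions of $n$. Then, as an identity of formal power series in $x$ and $y$ over $\mathbb{Q}$, \begin{align*} 2\sum_{n=1}^\infty \sum_{k=2}^\infty a_{n,k}x^ny^k &= \left(P(x) - \frac{1}{1-x}\right)^2 \frac{x^2y^2}{1 -x+xy -xyP(x)} \\ &\quad+\frac{1}{1-x} \left(P(x^2) - \frac{1}{1-x^2}\right) \frac{x^2y^2}{1 -\frac{(P(x^2)-1) x^2y^2}{1-x^2}}\\ &\quad+\left(P(x^2) - \frac{1}{1-x^2}\right)\left(\frac{P(x)-1}{1-x^2}\right) \frac{x^3y^3}{1 -\frac{(P(x^2)-1) x^2y^2}{1-x^2}}. \end{align*} -/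

import Mathlib

namespace LinearTrees

/-- The set of high degree vertices (HDVs) of a finite simple graph: those of degree at least 3. -/
def hdv {V : Type*} [Finite V] (G : SimpleGraph V) : Set V :=
  {v | 3 ≤ (G.neighborSet v).ncard}

/-- A linear tree: a tree all of whose HDVs lie on a single induced path, i.e. on an induced
subgraph isomorphic to a path graph. -/
def IsLinearTree {V : Type*} [Finite V] (G : SimpleGraph V) : Prop :=
  G.IsTree ∧ ∃ (m : ℕ) (f : SimpleGraph.pathGraph m ↪g G), hdv G ⊆ Set.range f

/-- A `k`-linear tree: a linear tree with exactly `k` HDVs. -/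
def IsKLinearTree {V : Type*} [Finite V] (k : ℕ) (G : SimpleGraph V) : Prop :=
  IsLinearTree G ∧ (hdv G).ncard = k

/-- The isomorphism relation on graphs with vertex set `Fin n`. -/
def isoSetoid (n : ℕ) : Setoid (SimpleGraph (Fin n)) where
  r G H := Nonempty (G ≃g H)
  iseqv :=
    ⟨fun _ => ⟨SimpleGraph.Iso.refl⟩, fun ⟨e⟩ => ⟨e.symm⟩, fun ⟨e⟩ ⟨f⟩ => ⟨e.trans f⟩⟩

/-- `a_{n,k}`: the number of isomorphism classes of `k`-linear trees on `n` vertices. -/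
noncomputable def numKLinearTrees (n k : ℕ) : ℕ :=
  (Quotient.mk (isoSetoid n) '' {G : SimpleGraph (Fin n) | IsKLinearTree k G}).ncard

/-- The partition generating function `P(t) = ∑ p(n) t ^ n`. -/
noncomputable def partitionGF : PowerSeries ℚ :=
  PowerSeries.mk fun n => (Fintype.card (Nat.Partition n) : ℚ)

/-- `∑_{n ≥ 1} ∑_{k ≥ 2} a_{n,k} x ^ n y ^ k`, a formal power series in `x = X 0`, `y = X 1`. -/
noncomputable def linearTreeGF : MvPowerSeries (Fin 2) ℚ :=
  fun e => if 1 ≤ e 0 ∧ 2 ≤ e 1 then (numKLinearTrees (e 0) (e 1) : ℚ) else 0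

end LinearTrees

/-!
A linear tree with at least two high degree vertices is a *leg graph*: a path (the *spine*), running
from the first to the last high degree vertex, with pendant paths (*legs*) attached to its vertices
(`exists_hasForks_iso`). Indeed, root the tree at the first vertex of the spine; a vertex
outside the spine has degree at most two, hence at most one child, so the part of the tree outside
the spine consists of paths. Both ends of the spine carry at least two legs.

The spine and the legs can be recovered from the tree up to reversal of the spine
(`legs_eq_or_eq_rev_of_iso`): an isomorphism maps leaves to leaves, and, going up from the
leaves, leg vertices to leg vertices, because a spine vertex next to a leg has degree at least
three; what is left are the spines, and a path has no automorphisms but the identity and the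
reversal. So isomorphism classes correspond to *codes* up to reversal, where a code lists the
multisets of leg lengths along the spine. As the classes are the orbits of an involution, twice
their number is the number of codes plus the number of palindromic codes
(`two_mul_numKLinearTrees`).

Codes and palindromic codes are counted by products and lists of multisets of leg lengths, that is,
of partitions. With `P = P(x)`, an inner vertex of the spine with its legs contributes
`x * (1 + y * (P - 1))` and an end contributes `x * y * (P - 1 / (1 - x))`, since `1 / (1 - x)`
counts the partitions with at most one part. A palindromic code is given by one end, the first half
of the inner vertices, all of which count twice, and possibly a middle vertex, which counts once.
-/

namespace LinearTrees

/-! ### Leg graphs -/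

/-- The tree obtained from a path with `N` vertices by attaching, for each `j : J`, a pendant path
(a *leg*) with `len j + 1` vertices to the vertex `b j` of that path (the *spine*). The `t`-th
vertex of the leg `j`, counted from the spine, is `Sum.inr ⟨j, t⟩`. Storing the number of vertices
minus one makes every leg nonempty. -/
def legGraph {N : ℕ} {J : Type*} (b : J → Fin N) (len : J → ℕ) :
    SimpleGraph (Fin N ⊕ Σ j, Fin (len j + 1)) where
  Adj
    | .inl i, .inl i' => i.val + 1 = i'.val ∨ i'.val + 1 = i.val
    | .inl i, .inr v => b v.1 = i ∧ v.2.val = 0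
    | .inr v, .inl i => b v.1 = i ∧ v.2.val = 0
    | .inr v, .inr w => v.1 = w.1 ∧ (v.2.val + 1 = w.2.val ∨ w.2.val + 1 = v.2.val)
  symm := ⟨by
    rintro (i | v) (i' | w) h
    · exact h.symm
    · exact h
    · exact h
    · exact ⟨h.1.symm, h.2.symm⟩⟩
  loopless := ⟨by
    rintro (i | v) h
    · simp at h
    · simp at h⟩

section legGraph

variable {N : ℕ} {J : Type*} {b : J → Fin N} {len : J → ℕ}

@[simp] lemma legGraph_adj_inl_inl {i i' : Fin N} :
    (legGraph b len).Adj (.inl i) (.inl i') ↔ i.val + 1 = i'.val ∨ i'.val + 1 = i.val := Iff.rfl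

@[simp] lemma legGraph_adj_inl_inr {i : Fin N} {v : Σ j, Fin (len j + 1)} :
    (legGraph b len).Adj (.inl i) (.inr v) ↔ b v.1 = i ∧ v.2.val = 0 := Iff.rfl

@[simp] lemma legGraph_adj_inr_inl {i : Fin N} {v : Σ j, Fin (len j + 1)} :
    (legGraph b len).Adj (.inr v) (.inl i) ↔ b v.1 = i ∧ v.2.val = 0 := Iff.rfl

@[simp] lemma legGraph_adj_inr_inr {v w : Σ j, Fin (len j + 1)} :
    (legGraph b len).Adj (.inr v) (.inr w) ↔
      v.1 = w.1 ∧ (v.2.val + 1 = w.2.val ∨ w.2.val + 1 = v.2.val) := Iff.rfl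

lemma sigma_fin_ext {v w : Σ j, Fin (len j + 1)} (h₁ : v.1 = w.1) (h₂ : v.2.val = w.2.val) :
    v = w := by
  obtain ⟨j, t⟩ := v
  obtain ⟨j', t'⟩ := w
  obtain rfl : j = j' := h₁
  obtain rfl : t = t' := Fin.ext h₂
  rfl

/-- A connected finite graph is a tree as soon as each edge joins a vertex other than the root to
its parent: this bounds the number of edges. -/
lemma isTree_of_parent {V : Type*} [Finite V] {G : SimpleGraph V} (hG : G.Connected) (r : V)
    (p : V → V) (h : ∀ v w, G.Adj v w → (v ≠ r ∧ p v = w) ∨ (w ≠ r ∧ p w = v)) : G.IsTree := by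
  refine SimpleGraph.isTree_iff_connected_and_card.2 ⟨hG, ?_⟩
  refine le_antisymm ?_ hG.card_vert_le_card_edgeSet_add_one
  have hsub : G.edgeSet ⊆ (fun v => s(v, p v)) '' {v | v ≠ r} := by
    intro e
    induction e with
    | h v w =>
      intro he
      rcases h v w he with ⟨hv, rfl⟩ | ⟨hw, rfl⟩
      · exact ⟨v, hv, rfl⟩
      · exact ⟨w, hw, Sym2.eq_swap⟩
  have h1 : G.edgeSet.ncard ≤ ({v | v ≠ r} : Set V).ncard :=
    (Set.ncard_le_ncard hsub).trans (Set.ncard_image_le)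
  have h2 : ({v | v ≠ r} : Set V).ncard + 1 = Nat.card V := by
    have := Set.ncard_add_ncard_compl ({r} : Set V)
    rw [Set.ncard_singleton] at this
    have h3 : ({v | v ≠ r} : Set V) = {r}ᶜ := rfl
    rw [h3]
    lia
  rw [Nat.card_coe_set_eq]
  lia

lemma legGraph_connected (hN : 0 < N) : (legGraph b len).Connected := by
  have hspine : ∀ (k : ℕ) (hk : k < N),
      (legGraph b len).Reachable (.inl ⟨0, hN⟩) (.inl ⟨k, hk⟩) := by
    intro k
    induction k with
    | zero => intro hk; exact SimpleGraph.Reachable.refl _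
    | succ k ih =>
      intro hk
      refine (ih (by lia)).trans (SimpleGraph.Adj.reachable ?_)
      simp
  have hleg : ∀ (j : J) (t : ℕ) (ht : t < len j + 1),
      (legGraph b len).Reachable (.inl (b j)) (.inr ⟨j, ⟨t, ht⟩⟩) := by
    intro j t
    induction t with
    | zero => intro ht; refine SimpleGraph.Adj.reachable ?_; simp
    | succ t ih =>
      intro ht
      refine (ih (by lia)).trans (SimpleGraph.Adj.reachable ?_)
      simp
  have hall : ∀ v, (legGraph b len).Reachable (.inl ⟨0, hN⟩) v := by
    rintro (i | ⟨j, t⟩)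
    · exact hspine i i.2
    · exact (hspine (b j) (b j).2).trans (hleg j t t.2)
  have : Nonempty (Fin N ⊕ Σ j, Fin (len j + 1)) := ⟨.inl ⟨0, hN⟩⟩
  exact ⟨fun v w => (hall v).symm.trans (hall w)⟩

lemma legGraph_isTree [Finite J] (hN : 0 < N) : (legGraph b len).IsTree := by
  refine isTree_of_parent (legGraph_connected hN) (.inl ⟨0, hN⟩)
    (Sum.elim (fun i => .inl ⟨i - 1, by lia⟩)
      (fun v => if v.2.val = 0 then .inl (b v.1) else .inr ⟨v.1, ⟨v.2 - 1, by lia⟩⟩)) ?_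
  rintro (i | v) (i' | w) h
  · rw [legGraph_adj_inl_inl] at h
    rcases h with h | h
    · right
      simp only [ne_eq, Sum.inl.injEq, Fin.ext_iff, Sum.elim_inl]
      lia
    · left
      simp only [ne_eq, Sum.inl.injEq, Fin.ext_iff, Sum.elim_inl]
      lia
  · rw [legGraph_adj_inl_inr] at h
    right
    exact ⟨by simp, (if_pos h.2).trans (congrArg Sum.inl h.1)⟩
  · rw [legGraph_adj_inr_inl] at h
    left
    exact ⟨by simp, (if_pos h.2).trans (congrArg Sum.inl h.1)⟩
  · rw [legGraph_adj_inr_inr] at h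
    rcases h with ⟨h1, h | h⟩
    · right
      refine ⟨by simp, ?_⟩
      rw [Sum.elim_inr, if_neg (by lia)]
      exact congrArg _ (sigma_fin_ext h1.symm (by simp; lia))
    · left
      refine ⟨by simp, ?_⟩
      rw [Sum.elim_inr, if_neg (by lia)]
      exact congrArg _ (sigma_fin_ext h1 (by simp; lia))

/-- The spine of a `legGraph` is an induced path. -/
def spineEmbedding (b : J → Fin N) (len : J → ℕ) : SimpleGraph.pathGraph N ↪g legGraph b len where
  toFun := .inl
  inj' := Sum.inl_injective
  map_rel_iff' := by
    intro i i'
    rw [SimpleGraph.pathGraph_adj]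
    exact Iff.rfl

/-- The spine has two distinct ends, each of which carries at least two legs; in other words, the
spine has at least two vertices and both its ends are high degree vertices. -/
def HasForks {N : ℕ} {J : Type*} (b : J → Fin N) : Prop :=
  2 ≤ N ∧ ∀ i : Fin N, i.val = 0 ∨ i.val + 1 = N → ∃ j j', j ≠ j' ∧ b j = i ∧ b j' = i

lemma mem_hdv_iff {V : Type*} [Finite V] {G : SimpleGraph V} {v : V} :
    v ∈ hdv G ↔ ∃ x y z, G.Adj v x ∧ G.Adj v y ∧ G.Adj v z ∧ x ≠ y ∧ x ≠ z ∧ y ≠ z := by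
  have h : v ∈ hdv G ↔ 2 < (G.neighborSet v).ncard := Iff.rfl
  rw [h, Set.two_lt_ncard_iff]
  rfl

lemma inr_notMem_hdv [Finite J] (v : Σ j, Fin (len j + 1)) : .inr v ∉ hdv (legGraph b len) := by
  rw [mem_hdv_iff]
  rintro ⟨x, y, z, hx, hy, hz, hxy, hxz, hyz⟩
  -- A neighbour of `v` is determined by its height above the spine, which takes two values only.
  let height : (Fin N ⊕ Σ j, Fin (len j + 1)) → ℕ := Sum.elim (fun _ => 0) (fun w => w.2.val + 1)
  have hval : ∀ x, (legGraph b len).Adj (.inr v) x →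
      height x = v.2.val ∨ height x = v.2.val + 2 := by
    rintro (i | w) h
    · simp only [legGraph_adj_inr_inl] at h
      simp [height, h.2]
    · simp only [legGraph_adj_inr_inr] at h
      simp only [height, Sum.elim_inr]
      lia
  have hinj : ∀ x y, (legGraph b len).Adj (.inr v) x → (legGraph b len).Adj (.inr v) y →
      x ≠ y → height x ≠ height y := by
    rintro (i | w) (i' | w') h h' hne heq
    · simp only [legGraph_adj_inr_inl] at h h'
      exact hne (by rw [← h.1, ← h'.1])
    · simp [height] at heq
    · simp [height] at heq
    · simp only [legGraph_adj_inr_inr] at h h'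
      simp only [height, Sum.elim_inr] at heq
      exact hne (congrArg _ (sigma_fin_ext (h.1.symm.trans h'.1) (by lia)))
  have := hinj x y hx hy hxy
  have := hinj x z hx hz hxz
  have := hinj y z hy hz hyz
  have := hval x hx
  have := hval y hy
  have := hval z hz
  lia

lemma exists_leg_of_inl_mem_hdv [Finite J] {i : Fin N} (h : .inl i ∈ hdv (legGraph b len)) :
    ∃ j, b j = i := by
  obtain ⟨x, y, z, hx, hy, hz, hxy, hxz, hyz⟩ := mem_hdv_iff.1 h
  rcases x with x | x
  · rcases y with y | y
    · rcases z with z | z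
      · simp only [legGraph_adj_inl_inl] at hx hy hz
        simp only [ne_eq, Sum.inl.injEq, Fin.ext_iff] at hxy hxz hyz
        lia
      · exact ⟨_, hz.1⟩
    · exact ⟨_, hy.1⟩
  · exact ⟨_, hx.1⟩

/-- A high degree vertex at an end of the spine carries two legs. -/
lemma exists_two_legs_of_inl_mem_hdv [Finite J] {i : Fin N} (hi : i.val = 0 ∨ i.val + 1 = N)
    (h : .inl i ∈ hdv (legGraph b len)) : ∃ j j', j ≠ j' ∧ b j = i ∧ b j' = i := by
  have key : ∀ v w : Σ j, Fin (len j + 1), (legGraph b len).Adj (.inl i) (.inr v) →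
      (legGraph b len).Adj (.inl i) (.inr w) →
      (.inr v : Fin N ⊕ Σ j, Fin (len j + 1)) ≠ .inr w →
      ∃ j j', j ≠ j' ∧ b j = i ∧ b j' = i := by
    intro v w hv hw hne
    exact ⟨v.1, w.1, fun h => hne (congrArg _ (sigma_fin_ext h (hv.2.trans hw.2.symm))), hv.1, hw.1⟩
  have hspine : ∀ x y : Fin N, (legGraph b len).Adj (.inl i) (.inl x) →
      (legGraph b len).Adj (.inl i) (.inl y) →
      (.inl x : Fin N ⊕ Σ j, Fin (len j + 1)) = .inl y := by
    intro x y hx hy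
    simp only [legGraph_adj_inl_inl] at hx hy
    simp only [Sum.inl.injEq, Fin.ext_iff]
    lia
  obtain ⟨x | x, y | y, z | z, hx, hy, hz, hxy, hxz, hyz⟩ := mem_hdv_iff.1 h
  · exact absurd (hspine _ _ hx hy) hxy
  · exact absurd (hspine _ _ hx hy) hxy
  · exact absurd (hspine _ _ hx hz) hxz
  · exact key _ _ hy hz hyz
  · exact absurd (hspine _ _ hy hz) hyz
  · exact key _ _ hx hz hxz
  · exact key _ _ hx hy hxy
  · exact key _ _ hx hy hxy

lemma HasForks.inl_mem_hdv_iff [Finite J] (hb : HasForks b) (len : J → ℕ) {i : Fin N} :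
    .inl i ∈ hdv (legGraph b len) ↔ ∃ j, b j = i := by
  refine ⟨exists_leg_of_inl_mem_hdv, ?_⟩
  rintro ⟨j, hj⟩
  obtain ⟨hN, hb⟩ := hb
  rw [mem_hdv_iff]
  by_cases hi : i.val = 0 ∨ i.val + 1 = N
  · obtain ⟨j₁, j₂, hne, h1, h2⟩ := hb i hi
    have hx : ∃ i' : Fin N, i.val + 1 = i'.val ∨ i'.val + 1 = i.val := by
      rcases hi with hi | hi
      · exact ⟨⟨1, by lia⟩, Or.inl (by simp; lia)⟩
      · exact ⟨⟨i - 1, by lia⟩, Or.inr (by simp; lia)⟩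
    obtain ⟨i', hi'⟩ := hx
    refine ⟨.inl i', .inr ⟨j₁, 0⟩, .inr ⟨j₂, 0⟩, hi', ?_, ?_, by simp, by simp, ?_⟩
    · simp [h1]
    · simp [h2]
    · intro h
      exact hne (congrArg Sigma.fst (Sum.inr_injective h))
  · refine ⟨.inl ⟨i - 1, by lia⟩, .inl ⟨i + 1, by lia⟩, .inr ⟨j, 0⟩, ?_, ?_, ?_, ?_, by simp,
      by simp⟩
    · simp; lia
    · simp
    · simp [hj]
    · simp

lemma HasForks.exists_two_adj_inl (hb : HasForks b) (len : J → ℕ) (i : Fin N) :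
    ∃ x y, x ≠ y ∧ (legGraph b len).Adj (.inl i) x ∧ (legGraph b len).Adj (.inl i) y := by
  by_cases hi : i.val = 0 ∨ i.val + 1 = N
  · obtain ⟨j₁, j₂, hne, h1, h2⟩ := hb.2 i hi
    refine ⟨.inr ⟨j₁, 0⟩, .inr ⟨j₂, 0⟩, ?_, by simp [h1], by simp [h2]⟩
    intro h
    exact hne (congrArg Sigma.fst (Sum.inr_injective h))
  · refine ⟨.inl ⟨i - 1, by lia⟩, .inl ⟨i + 1, by lia⟩, ?_, ?_, ?_⟩
    · simp
    · simp; lia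
    · simp

lemma HasForks.hdv_legGraph [Finite J] (hb : HasForks b) (len : J → ℕ) :
    hdv (legGraph b len) = Sum.inl '' Set.range b := by
  ext v
  rcases v with i | v
  · rw [hb.inl_mem_hdv_iff]
    simp
  · simp [inr_notMem_hdv]

lemma HasForks.isLinearTree_legGraph [Finite J] (hb : HasForks b) (len : J → ℕ) :
    IsLinearTree (legGraph b len) := by
  refine ⟨legGraph_isTree (by have := hb.1; lia), N, spineEmbedding b len, ?_⟩
  rw [hb.hdv_legGraph]
  rintro _ ⟨i, -, rfl⟩
  exact ⟨i, rfl⟩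

lemma apply_mem_hdv {V W : Type*} [Finite V] [Finite W] {G : SimpleGraph V} {H : SimpleGraph W}
    (φ : G ≃g H) {v : V} (hv : v ∈ hdv G) : φ v ∈ hdv H := by
  obtain ⟨x, y, z, hx, hy, hz, hxy, hxz, hyz⟩ := mem_hdv_iff.1 hv
  exact mem_hdv_iff.2 ⟨φ x, φ y, φ z, φ.map_adj_iff.2 hx, φ.map_adj_iff.2 hy,
    φ.map_adj_iff.2 hz, φ.injective.ne hxy, φ.injective.ne hxz, φ.injective.ne hyz⟩

lemma apply_mem_hdv_iff {V W : Type*} [Finite V] [Finite W] {G : SimpleGraph V}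
    {H : SimpleGraph W} (φ : G ≃g H) {v : V} : φ v ∈ hdv H ↔ v ∈ hdv G :=
  ⟨fun h => by simpa using apply_mem_hdv φ.symm h, apply_mem_hdv φ⟩

lemma image_hdv {V W : Type*} [Finite V] [Finite W] {G : SimpleGraph V} {H : SimpleGraph W}
    (φ : G ≃g H) : φ '' hdv G = hdv H := by
  ext w
  refine ⟨?_, fun hw => ⟨φ.symm w, apply_mem_hdv φ.symm hw, by simp⟩⟩
  rintro ⟨v, hv, rfl⟩
  exact apply_mem_hdv φ hv

lemma IsKLinearTree.of_iso {V W : Type*} [Finite V] [Finite W] {G : SimpleGraph V}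
    {H : SimpleGraph W} {k : ℕ} (φ : G ≃g H) (hG : IsKLinearTree k G) : IsKLinearTree k H := by
  obtain ⟨⟨htree, m, f, hf⟩, hk⟩ := hG
  refine ⟨⟨φ.isTree_iff.1 htree, m, φ.toEmbedding.comp f, ?_⟩, ?_⟩
  · rw [← image_hdv φ]
    rintro _ ⟨v, hv, rfl⟩
    obtain ⟨i, rfl⟩ := hf hv
    exact ⟨i, rfl⟩
  · rw [← image_hdv φ, Set.ncard_image_of_injective _ φ.injective, hk]

end legGraph

/-! ### Isomorphisms of leg graphs -/

section rigidity

/-- The multiset of the (shifted) lengths of the legs at each vertex of the spine. -/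
def legs {N : ℕ} {J : Type*} [Fintype J] (b : J → Fin N) (len : J → ℕ) (i : Fin N) :
    Multiset ℕ :=
  (Finset.univ.filter fun j => b j = i).val.map len

lemma count_legs {N : ℕ} {J : Type*} [Fintype J] (b : J → Fin N) (len : J → ℕ) (i : Fin N)
    (a : ℕ) : (legs b len i).count a = Fintype.card {j // (b j, len j) = (i, a)} := by
  rw [legs, Multiset.count_map, ← Finset.filter_val, Finset.card_val, Finset.filter_filter,
    Fintype.card_subtype]
  congr 1
  ext j
  simp [eq_comm]

variable {N N' : ℕ} {J J' : Type*} {b : J → Fin N} {len : J → ℕ} {b' : J' → Fin N'}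
  {len' : J' → ℕ}

/-- Two families of legs with the same lengths at each vertex of the spine differ by a
relabelling. -/
lemma exists_equiv_of_legs_eq [Fintype J] [Fintype J'] {b' : J' → Fin N}
    (h : legs b len = legs b' len') :
    ∃ e : J ≃ J', (∀ j, b' (e j) = b j) ∧ ∀ j, len' (e j) = len j := by
  have hcard : ∀ c : Fin N × ℕ,
      Nonempty ({j // (b j, len j) = c} ≃ {j // (b' j, len' j) = c}) := by
    rintro ⟨i, a⟩
    rw [← Fintype.card_eq, ← count_legs, ← count_legs, h]
  have e : ∀ c : Fin N × ℕ, {j // (b j, len j) = c} ≃ {j // (b' j, len' j) = c} :=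
    fun c => Classical.choice (hcard c)
  have key : ∀ j, (b' (Equiv.ofFiberEquiv e j), len' (Equiv.ofFiberEquiv e j)) = (b j, len j) :=
    fun j => Equiv.ofFiberEquiv_map e j
  exact ⟨Equiv.ofFiberEquiv e, fun j => congrArg Prod.fst (key j),
    fun j => congrArg Prod.snd (key j)⟩

lemma legs_comp_equiv [Fintype J] [Fintype J'] (σ : Fin N ≃ Fin N') (e : J ≃ J')
    (hb : ∀ j, b' (e j) = σ (b j)) (hlen : ∀ j, len' (e j) = len j) (i : Fin N) :
    legs b' len' (σ i) = legs b len i := by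
  ext a
  rw [count_legs, count_legs]
  refine (Fintype.card_congr (e.subtypeEquiv fun j => ?_)).symm
  simp [hb, hlen]

/-- An automorphism of the spine together with a compatible relabelling of the legs. -/
lemma nonempty_iso_of_equiv (σ : SimpleGraph.pathGraph N ≃g SimpleGraph.pathGraph N') (e : J ≃ J')
    (hb : ∀ j, b' (e j) = σ (b j)) (hlen : ∀ j, len' (e j) = len j) :
    Nonempty (legGraph b len ≃g legGraph b' len') := by
  let E : (Σ j, Fin (len j + 1)) ≃ Σ j, Fin (len' j + 1) :=
    Equiv.sigmaCongr e fun j => finCongr (by rw [hlen])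
  have hE1 : ∀ v, (E v).1 = e v.1 := fun v => rfl
  have hE2 : ∀ v, (E v).2.val = v.2.val := fun v => rfl
  refine ⟨⟨Equiv.sumCongr σ.toEquiv E, ?_⟩⟩
  have hσ : ∀ i i' : Fin N, ((σ i).val + 1 = (σ i').val ∨ (σ i').val + 1 = (σ i).val) ↔
      (i.val + 1 = i'.val ∨ i'.val + 1 = i.val) := by
    intro i i'
    rw [← SimpleGraph.pathGraph_adj, ← SimpleGraph.pathGraph_adj]
    exact σ.map_adj_iff
  rintro (i | v) (i' | w)
  · exact hσ i i'
  · simp [hE1, hE2, hb]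
  · simp [hE1, hE2, hb]
  · simp [hE1, hE2]

lemma nonempty_iso_of_legs_eq [Fintype J] [Fintype J'] {b' : J' → Fin N}
    (h : legs b len = legs b' len') : Nonempty (legGraph b len ≃g legGraph b' len') := by
  obtain ⟨e, h1, h2⟩ := exists_equiv_of_legs_eq h
  exact nonempty_iso_of_equiv SimpleGraph.Iso.refl e h1 h2

/-- Reversal of the path graph. -/
def pathGraphRev (N : ℕ) : SimpleGraph.pathGraph N ≃g SimpleGraph.pathGraph N where
  toEquiv := Fin.revPerm
  map_rel_iff' := by
    intro i i'
    simp only [SimpleGraph.pathGraph_adj, Fin.revPerm_apply, Fin.val_rev]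
    lia

lemma nonempty_iso_of_legs_eq_rev [Fintype J] [Fintype J'] {b' : J' → Fin N}
    (h : ∀ i, legs b len i = legs b' len' i.rev) :
    Nonempty (legGraph b len ≃g legGraph b' len') := by
  obtain ⟨φ⟩ := nonempty_iso_of_equiv (b := b) (len := len) (b' := fun j => (b j).rev)
    (len' := len) (pathGraphRev N) (Equiv.refl J) (fun _ => rfl) (fun _ => rfl)
  have h' : legs (fun j => (b j).rev) len = legs b' len' := by
    funext i
    have := legs_comp_equiv (b := b) (len := len) (b' := fun j => (b j).rev)
      (len' := len) Fin.revPerm (Equiv.refl J) (fun _ => rfl) (fun _ => rfl) i.rev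
    simp only [Fin.revPerm_apply, Fin.rev_rev] at this
    rw [this, h, Fin.rev_rev]
  obtain ⟨ψ⟩ := nonempty_iso_of_legs_eq h'
  exact ⟨φ.trans ψ⟩

/-- An isomorphism cannot move a leg vertex into the spine. Going down a leg from its tip: the tip
is a leaf, while a spine vertex is not; and a spine vertex next to a leg vertex is a high degree
vertex, while leg vertices are not. -/
lemma exists_apply_inr [Finite J] [Finite J'] (hb' : HasForks b')
    (φ : legGraph b len ≃g legGraph b' len') (v : Σ j, Fin (len j + 1)) :
    ∃ w, φ (.inr v) = .inr w := by
  obtain ⟨j, t⟩ := v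
  have key : ∀ (s : ℕ) (hs : s ≤ len j), ∃ w, φ (.inr ⟨j, ⟨len j - s, by lia⟩⟩) = .inr w := by
    intro s
    induction s with
    | zero =>
      intro hs
      rcases hφ : φ (.inr ⟨j, ⟨len j - 0, by lia⟩⟩) with i | w
      · exfalso
        obtain ⟨x, y, hne, hx, hy⟩ := hb'.exists_two_adj_inl len' i
        obtain ⟨x, rfl⟩ := φ.surjective x
        obtain ⟨y, rfl⟩ := φ.surjective y
        rw [← hφ, φ.map_adj_iff] at hx hy
        refine hne (congrArg φ ?_)
        rcases x with x | x <;> rcases y with y | y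
        · exact congrArg _ (hx.1.symm.trans hy.1)
        · have h1 := hx.2
          have h2 := hy.2
          have h3 := y.2.2
          have h4 : len y.1 = len j := congrArg len hy.1.symm
          simp only at h1 h2
          lia
        · have h1 := hx.2
          have h2 := hy.2
          have h3 := x.2.2
          have h4 : len x.1 = len j := congrArg len hx.1.symm
          simp only at h1 h2
          lia
        · have h1 := hx.2
          have h2 := hy.2
          have h3 := x.2.2
          have h4 : len x.1 = len j := congrArg len hx.1.symm
          have h5 := y.2.2
          have h6 : len y.1 = len j := congrArg len hy.1.symm
          simp only at h1 h2
          exact congrArg _ (sigma_fin_ext (hx.1.symm.trans hy.1) (by lia))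
      · exact ⟨w, rfl⟩
    | succ s ih =>
      intro hs
      obtain ⟨w, hw⟩ := ih (by lia)
      rcases hφ : φ (.inr ⟨j, ⟨len j - (s + 1), by lia⟩⟩) with i | w'
      · exfalso
        have hadj : (legGraph b' len').Adj (.inl i) (.inr w) := by
          rw [← hφ, ← hw, φ.map_adj_iff, legGraph_adj_inr_inr]
          exact ⟨rfl, Or.inl (by simp only; lia)⟩
        have h := (hb'.inl_mem_hdv_iff len').2 ⟨_, hadj.1⟩
        rw [← hφ, apply_mem_hdv_iff φ] at h
        exact inr_notMem_hdv _ h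
      · exact ⟨w', rfl⟩
  obtain ⟨w, hw⟩ := key (len j - t) (by lia)
  refine ⟨w, ?_⟩
  rw [← hw]
  refine congrArg φ (congrArg _ (sigma_fin_ext rfl ?_))
  simp only
  lia

lemma exists_apply_inl [Finite J] [Finite J'] (hb : HasForks b)
    (φ : legGraph b len ≃g legGraph b' len') (i : Fin N) : ∃ i', φ (.inl i) = .inl i' := by
  rcases hφ : φ (.inl i) with i' | w
  · exact ⟨i', rfl⟩
  · obtain ⟨v, hv⟩ := exists_apply_inr hb φ.symm w
    rw [← hφ, RelIso.symm_apply_apply] at hv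
    cases hv

/-- An isomorphism that respects the spines carries each leg onto a leg, keeping the distance to
the spine. -/
lemma exists_apply_leg [Finite J] [Finite J'] (hb' : HasForks b')
    (φ : legGraph b len ≃g legGraph b' len') {σ : Fin N → Fin N'}
    (hσ : ∀ i, φ (.inl i) = .inl (σ i)) (j : J) :
    ∃ j', b' j' = σ (b j) ∧ ∀ (t : ℕ) (ht : t < len j + 1),
      ∃ w, φ (.inr ⟨j, ⟨t, ht⟩⟩) = .inr w ∧ w.1 = j' ∧ w.2.val = t := by
  obtain ⟨w₀, hw₀⟩ := exists_apply_inr hb' φ ⟨j, 0⟩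
  have hadj₀ : (legGraph b' len').Adj (.inl (σ (b j))) (.inr w₀) := by
    rw [← hw₀, ← hσ, φ.map_adj_iff]
    simp
  refine ⟨w₀.1, hadj₀.1, ?_⟩
  intro t
  induction t using Nat.strong_induction_on with
  | _ t ih =>
    intro ht
    rcases t with _ | t
    · exact ⟨w₀, hw₀, rfl, hadj₀.2⟩
    · obtain ⟨w, hw, hw1, hw2⟩ := ih t (by lia) (by lia)
      obtain ⟨w', hw'⟩ := exists_apply_inr hb' φ ⟨j, ⟨t + 1, ht⟩⟩
      have hadj : (legGraph b' len').Adj (.inr w) (.inr w') := by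
        rw [← hw, ← hw', φ.map_adj_iff, legGraph_adj_inr_inr]
        simp
      refine ⟨w', hw', hadj.1.symm.trans hw1, ?_⟩
      rcases hadj.2 with h | h
      · lia
      · -- the vertex below `w` is already the image of the vertex below the `t`-th one
        exfalso
        obtain ⟨w'', hw'', h1, h2⟩ := ih (t - 1) (by lia) (by lia)
        have : w'' = w' := sigma_fin_ext (h1.trans (hw1.symm.trans hadj.1)) (by lia)
        rw [this, ← hw'] at hw''
        have h3 := φ.injective hw''
        simp only [Sum.inr.injEq, Sigma.mk.injEq, heq_eq_eq, Fin.mk.injEq, true_and] at h3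
        lia

lemma exists_leg_equiv [Finite J] [Finite J'] (hb : HasForks b) (hb' : HasForks b')
    (φ : legGraph b len ≃g legGraph b' len') (σ : Fin N ≃ Fin N')
    (hσ : ∀ i, φ (.inl i) = .inl (σ i)) :
    ∃ e : J ≃ J', (∀ j, b' (e j) = σ (b j)) ∧ ∀ j, len' (e j) = len j := by
  have hσ' : ∀ i, φ.symm (.inl i) = .inl (σ.symm i) := by
    intro i
    rw [RelIso.symm_apply_eq, hσ, Equiv.apply_symm_apply]
  choose f hf1 hf2 using exists_apply_leg hb' φ hσ
  choose g hg1 hg2 using exists_apply_leg hb φ.symm hσ'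
  have hf0 : ∀ j, φ (.inr ⟨j, 0⟩) = .inr ⟨f j, 0⟩ := by
    intro j
    obtain ⟨w, hw, h1, h2⟩ := hf2 j 0 (by lia)
    exact hw.trans (congrArg _ (sigma_fin_ext h1 h2))
  have hg0 : ∀ j, φ.symm (.inr ⟨j, 0⟩) = .inr ⟨g j, 0⟩ := by
    intro j
    obtain ⟨w, hw, h1, h2⟩ := hg2 j 0 (by lia)
    exact hw.trans (congrArg _ (sigma_fin_ext h1 h2))
  have hgf : ∀ j, g (f j) = j := by
    intro j
    have h := hg0 (f j)
    rw [← hf0, RelIso.symm_apply_apply] at h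
    exact (congrArg Sigma.fst (Sum.inr_injective h)).symm
  have hfg : ∀ j, f (g j) = j := by
    intro j
    have h := hf0 (g j)
    rw [← hg0, RelIso.apply_symm_apply] at h
    exact (congrArg Sigma.fst (Sum.inr_injective h)).symm
  have hle : ∀ j, len j ≤ len' (f j) := by
    intro j
    obtain ⟨w, -, h1, h2⟩ := hf2 j (len j) (by lia)
    have := w.2.2
    have := congrArg len' h1
    lia
  have hle' : ∀ j, len' j ≤ len (g j) := by
    intro j
    obtain ⟨w, -, h1, h2⟩ := hg2 j (len' j) (by lia)
    have := w.2.2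
    have := congrArg len h1
    lia
  refine ⟨⟨f, g, hgf, hfg⟩, hf1, fun j => le_antisymm ?_ (hle j)⟩
  have := hle' (f j)
  rwa [hgf] at this

/-- The only injections of a path to itself that respect adjacency are the identity and the
reversal. -/
lemma eq_self_or_eq_rev {σ : Fin N → Fin N} (hinj : Function.Injective σ)
    (hadj : ∀ i i' : Fin N, i.val + 1 = i'.val →
      (σ i).val + 1 = (σ i').val ∨ (σ i').val + 1 = (σ i).val) :
    (∀ i, σ i = i) ∨ ∀ i, σ i = i.rev := by
  rcases lt_or_ge N 2 with hN | hN
  · left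
    intro i
    ext
    lia
  -- the direction of the first step determines all others
  have key : ∀ ε : ℤ, (ε = 1 ∨ ε = -1) →
      (((σ ⟨1, by lia⟩).val : ℤ) = (σ ⟨0, by lia⟩).val + ε) →
      ∀ (k : ℕ) (hk : k < N), ((σ ⟨k, hk⟩).val : ℤ) = (σ ⟨0, by lia⟩).val + ε * k := by
    intro ε hε h1 k
    induction k using Nat.strong_induction_on with
    | _ k ih =>
      intro hk
      rcases k with _ | _ | k
      · simp
      · simpa using h1
      · have h2 := ih (k + 1) (by lia) (by lia)
        have h3 := ih k (by lia) (by lia)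
        have h4 := hadj ⟨k + 1, by lia⟩ ⟨k + 2, hk⟩ rfl
        have h5 : (σ ⟨k + 2, hk⟩).val ≠ (σ ⟨k, by lia⟩).val := fun h => by
          have := hinj (Fin.ext h)
          simp at this
        push_cast at h2 ⊢
        rcases hε with rfl | rfl <;> lia
  have h01 := hadj ⟨0, by lia⟩ ⟨1, by lia⟩ rfl
  rcases h01 with h | h
  · left
    have hk := key 1 (Or.inl rfl) (by lia)
    have hlast := hk (N - 1) (by lia)
    have hlt := (σ ⟨N - 1, by lia⟩).2
    intro i
    have := hk i i.2
    ext
    simp only [Fin.eta] at this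
    omega
  · right
    have hk := key (-1) (Or.inr rfl) (by lia)
    have hlast := hk (N - 1) (by lia)
    intro i
    have := hk i i.2
    ext
    simp only [Fin.eta] at this
    rw [Fin.val_rev]
    lia

/-- Isomorphic leg graphs have spines of the same length, and the same legs up to reversal. -/
theorem legs_eq_or_eq_rev_of_iso [Fintype J] [Fintype J'] (hb : HasForks b) (hb' : HasForks b')
    (φ : legGraph b len ≃g legGraph b' len') :
    ∃ h : N = N', (∀ i, legs b' len' (Fin.cast h i) = legs b len i) ∨
      ∀ i, legs b' len' (Fin.cast h i) = legs b len i.rev := by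
  choose σ hσ using exists_apply_inl hb φ
  choose τ hτ using exists_apply_inl hb' φ.symm
  have hτσ : ∀ i, τ (σ i) = i := by
    intro i
    have := hτ (σ i)
    rw [← hσ, RelIso.symm_apply_apply] at this
    exact (Sum.inl_injective this).symm
  have hστ : ∀ i, σ (τ i) = i := by
    intro i
    have := hσ (τ i)
    rw [← hτ, RelIso.apply_symm_apply] at this
    exact (Sum.inl_injective this).symm
  let s : Fin N ≃ Fin N' := ⟨σ, τ, hτσ, hστ⟩
  obtain rfl : N = N' := by simpa using Fintype.card_congr s
  obtain ⟨e, he1, he2⟩ := exists_leg_equiv hb hb' φ s hσ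
  have hlegs := legs_comp_equiv s e he1 he2
  refine ⟨rfl, ?_⟩
  have hadj : ∀ i i' : Fin N, i.val + 1 = i'.val →
      (σ i).val + 1 = (σ i').val ∨ (σ i').val + 1 = (σ i).val := by
    intro i i' h
    rw [← legGraph_adj_inl_inl (b := b') (len := len'), ← hσ, ← hσ, φ.map_adj_iff]
    exact Or.inl h
  rcases eq_self_or_eq_rev s.injective hadj with h | h
  · left
    intro i
    have := hlegs i
    rwa [show s i = i from h i] at this
  · right
    intro i
    have := hlegs i.rev
    rwa [show s i.rev = i.rev.rev from h i.rev, Fin.rev_rev] at this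

end rigidity

/-! ### Linear trees are leg graphs -/

section extraction

/-- A finite tree with a root has a parent function, whose edges are all the edges; `d` is the
distance to the root. -/
lemma exists_parent {V : Type*} [Finite V] {G : SimpleGraph V} (hG : G.IsTree) (r : V) :
    ∃ (p : V → V) (d : V → ℕ), (∀ v, v ≠ r → d (p v) + 1 = d v) ∧
      ∀ v w, G.Adj v w ↔ (v ≠ r ∧ p v = w) ∨ (w ≠ r ∧ p w = v) := by
  have hex : ∀ v, ∃ w, v ≠ r → G.Adj v w ∧ G.dist w r + 1 = G.dist v r := by
    intro v
    by_cases hv : v = r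
    · exact ⟨v, fun h => absurd hv h⟩
    · obtain ⟨q, hq⟩ := hG.connected.exists_walk_length_eq_dist v r
      cases q with
      | nil => exact absurd rfl hv
      | @cons _ w _ h q =>
        refine ⟨w, fun _ => ⟨h, ?_⟩⟩
        rw [SimpleGraph.Walk.length_cons] at hq
        have h1 := SimpleGraph.dist_le q
        have h2 := hG.connected.dist_triangle (u := v) (v := w) (w := r)
        have h3 : G.dist v w = 1 := SimpleGraph.dist_eq_one_iff_adj.2 h
        lia
  choose p hp using hex
  refine ⟨p, fun v => G.dist v r, fun v hv => (hp v hv).2, ?_⟩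
  have hinj : Set.InjOn (fun v => s(v, p v)) {v | v ≠ r} := by
    intro v hv w hw h
    rcases Sym2.eq_iff.1 h with h | h
    · exact h.1
    · have h1 := (hp v hv).2
      have h2 := (hp w hw).2
      rw [h.2] at h1
      rw [← h.1] at h2
      lia
  have hsub : (fun v => s(v, p v)) '' {v | v ≠ r} ⊆ G.edgeSet := by
    rintro _ ⟨v, hv, rfl⟩
    exact (hp v hv).1
  -- there are as many edges as vertices other than the root
  have hcard : G.edgeSet.ncard ≤ ((fun v => s(v, p v)) '' {v | v ≠ r}).ncard := by
    rw [hinj.ncard_image]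
    have h1 := (SimpleGraph.isTree_iff_connected_and_card.1 hG).2
    have h2 := Set.ncard_add_ncard_compl ({r} : Set V)
    rw [Set.ncard_singleton] at h2
    have h3 : ({v | v ≠ r} : Set V) = {r}ᶜ := rfl
    rw [Nat.card_coe_set_eq] at h1
    rw [h3]
    lia
  have heq := Set.eq_of_subset_of_ncard_le hsub hcard
  intro v w
  rw [← SimpleGraph.mem_edgeSet, ← heq]
  constructor
  · rintro ⟨x, hx, h⟩
    rcases Sym2.eq_iff.1 h with ⟨rfl, h'⟩ | ⟨rfl, h'⟩
    · exact Or.inl ⟨hx, h'⟩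
    · exact Or.inr ⟨hx, h'⟩
  · rintro (⟨h, rfl⟩ | ⟨h, rfl⟩)
    · exact ⟨v, h, rfl⟩
    · exact ⟨w, h, Sym2.eq_swap⟩

/-- A function to `ℕ` on a finite type whose range is downward closed stays below the number of
elements of the type. -/
lemma lt_card_of_downward_closed {X : Type*} [Fintype X] {g : X → ℕ}
    (hdown : ∀ x n, n < g x → ∃ y, g y = n) (x : X) : g x < Fintype.card X := by
  classical
  have hsub : Finset.range (g x + 1) ⊆ Finset.univ.image g := by
    intro n hn
    rw [Finset.mem_range] at hn
    rcases Nat.lt_succ_iff_lt_or_eq.1 hn with h | rfl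
    · obtain ⟨y, hy⟩ := hdown x n h
      exact Finset.mem_image.2 ⟨y, Finset.mem_univ _, hy⟩
    · exact Finset.mem_image_of_mem _ (Finset.mem_univ _)
  have h1 := Finset.card_le_card hsub
  rw [Finset.card_range] at h1
  have h2 : (Finset.univ.image g).card ≤ Fintype.card X := Finset.card_image_le
  lia

/-- A finite tree with an induced path that contains all high degree vertices is a leg graph over
this path. With the parents taken towards the first vertex of the path, the vertices outside
the path have at most one child each, so that every one of them is determined by the first vertex
outside the path on its way to the root (the foot of its leg) and by its height above the path. -/
theorem exists_legGraph_iso {V : Type} [Finite V] {G : SimpleGraph V} (hG : G.IsTree) {N : ℕ}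
    (hN : 0 < N) (u : SimpleGraph.pathGraph N ↪g G) (hu : hdv G ⊆ Set.range u) :
    ∃ (J : Type) (_ : Fintype J) (b : J → Fin N) (len : J → ℕ) (φ : G ≃g legGraph b len),
      ∀ i, φ (u i) = .inl i := by
  classical
  have := Fintype.ofFinite V
  obtain ⟨p, d, hd, hadj⟩ := exists_parent hG (u ⟨0, hN⟩)
  set r := u ⟨0, hN⟩ with hr
  set S : Set V := Set.range u with hS
  have hrS : r ∈ S := ⟨_, rfl⟩
  have hne : ∀ {v}, v ∉ S → v ≠ r := fun hv h => hv (h ▸ hrS)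
  have hadjp : ∀ {v}, v ≠ r → G.Adj v (p v) := fun {v} hv => (hadj v (p v)).2 (Or.inl ⟨hv, rfl⟩)
  -- parents of spine vertices
  have hpu : ∀ (i : ℕ) (hi : i + 1 < N), p (u ⟨i + 1, hi⟩) = u ⟨i, by lia⟩ := by
    intro i
    induction i with
    | zero =>
      intro hi
      have h : G.Adj (u ⟨0, by lia⟩) (u ⟨0 + 1, hi⟩) := by
        rw [u.map_adj_iff, SimpleGraph.pathGraph_adj]
        exact Or.inl rfl
      rcases (hadj _ _).1 h with h | h
      · exact absurd rfl h.1
      · exact h.2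
    | succ i ih =>
      intro hi
      have h : G.Adj (u ⟨i + 1, by lia⟩) (u ⟨i + 1 + 1, hi⟩) := by
        rw [u.map_adj_iff, SimpleGraph.pathGraph_adj]
        exact Or.inl rfl
      rcases (hadj _ _).1 h with h | h
      · have h1 := (ih (by lia)).symm.trans h.2
        have h2 := u.injective h1
        simp only [Fin.mk.injEq] at h2
        lia
      · exact h.2
  have hpS : ∀ v ∈ S, v ≠ r → p v ∈ S := by
    rintro _ ⟨⟨i, hi⟩, rfl⟩ hv
    rcases i with _ | i
    · exact absurd rfl hv
    · exact ⟨_, (hpu i hi).symm⟩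
  -- height above the spine and foot of the leg
  have hheight : ∃ h : V → ℕ, (∀ v ∈ S, h v = 0) ∧ ∀ v ∉ S, h v = h (p v) + 1 := by
    have hex : ∀ v, ∃ k, p^[k] v ∈ S := by
      have key : ∀ n v, d v = n → ∃ k, p^[k] v ∈ S := by
        intro n
        induction n with
        | zero =>
          intro v hv
          by_cases h : v = r
          · exact ⟨0, h ▸ hrS⟩
          · have := hd v h
            lia
        | succ n ih =>
          intro v hv
          by_cases h : v = r
          · exact ⟨0, h ▸ hrS⟩
          · obtain ⟨k, hk⟩ := ih (p v) (by have := hd v h; lia)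
            exact ⟨k + 1, hk⟩
      exact fun v => key _ v rfl
    refine ⟨fun v => Nat.find (hex v), fun v hv => ?_, fun v hv => ?_⟩
    · exact (Nat.find_eq_zero _).2 hv
    · exact Nat.find_comp_succ (hex v) (hex (p v)) hv
  obtain ⟨h, hh0, hh1⟩ := hheight
  have hpos : ∀ {v}, v ∉ S → 0 < h v := fun hv => by rw [hh1 _ hv]; lia
  have hS0 : ∀ {v}, h v = 0 → v ∈ S := by
    intro v hv
    by_contra hvS
    have := hpos hvS
    lia
  have hfoot : ∃ f : V → V, (∀ v ∉ S, p v ∈ S → f v = v) ∧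
      ∀ v ∉ S, p v ∉ S → f v = f (p v) := by
    refine ⟨fun v => p^[h v - 1] v, fun v hv hpv => ?_, fun v hv hpv => ?_⟩
    · simp [hh1 v hv, hh0 _ hpv]
    · have h1 := hh1 v hv
      have h2 := hpos hpv
      have h3 : h v - 1 = (h (p v) - 1) + 1 := by lia
      simp only [h3, Function.iterate_succ, Function.comp_apply]
  obtain ⟨f, hf0, hf1⟩ := hfoot
  -- vertices outside the spine have at most one child
  have hchild : ∀ v w, v ∉ S → w ∉ S → p v = p w → p v ∉ S → v = w := by
    intro v w hv hw hvw hpv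
    by_contra hne'
    have hmem : p v ∈ hdv G := by
      refine mem_hdv_iff.2 ⟨v, w, p (p v), (hadjp (hne hv)).symm, ?_, hadjp (hne hpv), hne',
        ?_, ?_⟩
      · rw [hvw]; exact (hadjp (hne hw)).symm
      · intro he
        have h1 := hd v (hne hv)
        have h2 := hd (p v) (hne hpv)
        rw [← he] at h2
        lia
      · intro he
        have h1 := hd w (hne hw)
        have h2 := hd (p v) (hne hpv)
        rw [← he] at h2
        rw [← hvw] at h1
        lia
    exact hpv (hu hmem)
  have hfJ : ∀ v ∉ S, f v ∉ S ∧ p (f v) ∈ S := by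
    have key : ∀ n v, h v = n → v ∉ S → f v ∉ S ∧ p (f v) ∈ S := by
      intro n
      induction n with
      | zero => exact fun v hv hvS => absurd (hS0 hv) hvS
      | succ n ih =>
        intro v hv hvS
        by_cases hpv : p v ∈ S
        · rw [hf0 v hvS hpv]
          exact ⟨hvS, hpv⟩
        · rw [hf1 v hvS hpv]
          exact ih (p v) (by have := hh1 v hvS; lia) hpv
    exact fun v hv => key _ v rfl hv
  have hinj : ∀ n v w, h v = n → h w = n → v ∉ S → w ∉ S → f v = f w → v = w := by
    intro n
    induction n with
    | zero => exact fun v w hv _ hvS => absurd (hS0 hv) hvS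
    | succ n ih =>
      intro v w hv hw hvS hwS hfeq
      have h1 := hh1 v hvS
      have h2 := hh1 w hwS
      rcases Nat.eq_zero_or_pos n with rfl | hn
      · rwa [hf0 v hvS (hS0 (by lia)), hf0 w hwS (hS0 (by lia))] at hfeq
      · have hpv : p v ∉ S := fun hc => by have := hh0 _ hc; lia
        have hpw : p w ∉ S := fun hc => by have := hh0 _ hc; lia
        rw [hf1 v hvS hpv, hf1 w hwS hpw] at hfeq
        exact hchild v w hvS hwS (ih _ _ (by lia) (by lia) hpv hpw hfeq) hpv
  let J : Type := {v : V // v ∉ S ∧ p v ∈ S}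
  let F : J → Type := fun j => {v : {v : V // v ∉ S} // (⟨f v, hfJ v v.2⟩ : J) = j}
  have hFne : ∀ j : J, Nonempty (F j) := fun j =>
    ⟨⟨⟨j, j.2.1⟩, Subtype.ext (hf0 j j.2.1 j.2.2)⟩⟩
  let len : J → ℕ := fun j => Fintype.card (F j) - 1
  have hlen : ∀ j, len j + 1 = Fintype.card (F j) := by
    intro j
    have := Fintype.card_pos_iff.2 (hFne j)
    simp only [len]
    lia
  have hlt : ∀ (j : J) (x : F j), h x.1 - 1 < len j + 1 := by
    intro j x
    rw [hlen]
    refine lt_card_of_downward_closed (g := fun x : F j => h x.1 - 1) ?_ x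
    have key : ∀ k (x : F j) n, h x.1 = k → n < h x.1 - 1 → ∃ y : F j, h y.1 - 1 = n := by
      intro k
      induction k with
      | zero => intro x n hx hn; lia
      | succ k ih =>
        intro x n hx hn
        have h1 := hh1 x.1 x.1.2
        have hpx : p x.1 ∉ S := fun hc => by have := hh0 _ hc; lia
        let y : F j := ⟨⟨p x.1, hpx⟩, (Subtype.ext (hf1 x.1 x.1.2 hpx).symm).trans x.2⟩
        have hy : h y.1 = k := by
          have : h y.1 = h (p x.1) := rfl
          lia
        rcases Nat.lt_or_ge n (h y.1 - 1) with hlt | hge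
        · exact ih y n hy hlt
        · exact ⟨y, by lia⟩
    exact fun x n hn => key _ x n rfl hn
  have hbij : ∀ j : J, Function.Bijective
      (fun x : F j => (⟨h x.1 - 1, hlt j x⟩ : Fin (len j + 1))) := by
    intro j
    rw [Fintype.bijective_iff_injective_and_card]
    refine ⟨fun x y hxy => ?_, by simp [hlen]⟩
    have h1 : h x.1 - 1 = h y.1 - 1 := congrArg Fin.val hxy
    have h2 := hpos x.1.2
    have h3 := hpos y.1.2
    have h4 : f x.1 = f y.1 := congrArg Subtype.val (x.2.trans y.2.symm)
    exact Subtype.ext (Subtype.ext (hinj _ _ _ (by lia) rfl x.1.2 y.1.2 h4))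
  let us : Fin N ≃ {v // v ∈ S} := Equiv.ofInjective u u.injective
  let b : J → Fin N := fun j => us.symm ⟨p j, j.2.2⟩
  have hb : ∀ (j : J) (i : Fin N), b j = i ↔ p j = u i := by
    intro j i
    rw [Equiv.symm_apply_eq, Subtype.ext_iff]
    rfl
  let E : {v // v ∉ S} ≃ Σ j, Fin (len j + 1) :=
    (Equiv.sigmaFiberEquiv fun v : {v // v ∉ S} => (⟨f v, hfJ v v.2⟩ : J)).symm.trans
      (Equiv.sigmaCongrRight fun j => Equiv.ofBijective _ (hbij j))
  have hE1 : ∀ v, ((E v).1 : V) = f v := fun v => rfl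
  have hE2 : ∀ v, (E v).2.val = h v - 1 := fun v => rfl
  let Φ : (Fin N ⊕ Σ j, Fin (len j + 1)) ≃ V :=
    (Equiv.sumCongr us E.symm).trans (Equiv.sumCompl (· ∈ S))
  have hΦl : ∀ i, Φ (.inl i) = u i := fun i => rfl
  have hΦr : ∀ w, Φ (.inr w) = E.symm w := fun w => rfl
  -- edges between the spine and a leg
  have hmixed : ∀ (i : Fin N) (v : {v // v ∉ S}),
      G.Adj (u i) v ↔ b (E v).1 = i ∧ (E v).2.val = 0 := by
    intro i v
    rw [hb, hE1, hE2, hadj]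
    have h1 := hh1 v v.2
    constructor
    · rintro (⟨h2, h3⟩ | ⟨h2, h3⟩)
      · exact absurd (h3 ▸ hpS _ ⟨i, rfl⟩ h2) v.2
      · have h4 : p v ∈ S := ⟨i, h3.symm⟩
        refine ⟨by rw [hf0 v v.2 h4, h3], ?_⟩
        rw [h1, hh0 _ h4]
    · rintro ⟨h2, h3⟩
      have h4 : p v ∈ S := hS0 (by lia)
      rw [hf0 v v.2 h4] at h2
      exact Or.inr ⟨hne v.2, h2⟩
  -- edges between leg vertices
  have hstep : ∀ v w : {v // v ∉ S}, p v = w ↔ (E v).1 = (E w).1 ∧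
      (E w).2.val + 1 = (E v).2.val := by
    intro v w
    rw [Subtype.ext_iff, hE1, hE1, hE2, hE2]
    have h1 := hh1 v v.2
    have h2 := hpos w.2
    constructor
    · intro hvw
      have hpv : p v ∉ S := hvw ▸ w.2
      refine ⟨by rw [hf1 v v.2 hpv, hvw], ?_⟩
      rw [h1, hvw]
      lia
    · rintro ⟨h3, h4⟩
      have hpv : p v ∉ S := fun hc => by have := hh0 _ hc; lia
      rw [hf1 v v.2 hpv] at h3
      exact hinj _ _ _ (by lia) rfl hpv w.2 h3
  have hiso : ∀ x y, G.Adj (Φ x) (Φ y) ↔ (legGraph b len).Adj x y := by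
    rintro (i | w) (i' | w')
    · rw [hΦl, hΦl, u.map_adj_iff, SimpleGraph.pathGraph_adj, legGraph_adj_inl_inl]
    · rw [hΦl, hΦr, hmixed, legGraph_adj_inl_inr, Equiv.apply_symm_apply]
    · rw [hΦl, hΦr, G.adj_comm, hmixed, legGraph_adj_inr_inl, Equiv.apply_symm_apply]
    · rw [hΦr, hΦr, hadj, hstep, hstep, legGraph_adj_inr_inr, Equiv.apply_symm_apply,
        Equiv.apply_symm_apply]
      have h1 := hne (E.symm w).2
      have h2 := hne (E.symm w').2
      constructor
      · rintro (⟨-, h3, h4⟩ | ⟨-, h3, h4⟩)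
        · exact ⟨h3, Or.inr h4⟩
        · exact ⟨h3.symm, Or.inl h4⟩
      · rintro ⟨h3, h4 | h4⟩
        · exact Or.inr ⟨h2, h3.symm, h4⟩
        · exact Or.inl ⟨h1, h3, h4⟩
  let Ψ : legGraph b len ≃g G := ⟨Φ, hiso _ _⟩
  refine ⟨J, inferInstance, b, len, Ψ.symm, fun i => ?_⟩
  rw [RelIso.symm_apply_eq]
  rfl

/-- A linear tree with at least two high degree vertices is a leg graph, over the part of the path
between its first and its last high degree vertex. -/
theorem exists_hasForks_iso {V : Type} [Finite V] {G : SimpleGraph V} (hG : IsLinearTree G)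
    (hk : 2 ≤ (hdv G).ncard) :
    ∃ (N : ℕ) (J : Type) (_ : Fintype J) (b : J → Fin N) (len : J → ℕ), HasForks b ∧
      Nonempty (G ≃g legGraph b len) := by
  classical
  obtain ⟨htree, m, f, hf⟩ := hG
  let A : Finset (Fin m) := Finset.univ.filter fun i => f i ∈ hdv G
  have hA : ∀ i, i ∈ A ↔ f i ∈ hdv G := fun i => by simp [A]
  obtain ⟨v, w, hv, hw, hvw⟩ := (Set.one_lt_ncard_iff (Set.toFinite _)).1 hk
  obtain ⟨iv, rfl⟩ := hf hv
  obtain ⟨iw, rfl⟩ := hf hw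
  have hne : A.Nonempty := ⟨iv, (hA iv).2 hv⟩
  have hv1 := A.min'_le iv ((hA iv).2 hv)
  have hv2 := A.le_max' iv ((hA iv).2 hv)
  have hw1 := A.min'_le iw ((hA iw).2 hw)
  have hw2 := A.le_max' iw ((hA iw).2 hw)
  have hmin := (hA _).1 (A.min'_mem hne)
  have hmax := (hA _).1 (A.max'_mem hne)
  set s := A.min' hne with hs
  set z := A.max' hne with hz
  have hivw : iv.val ≠ iw.val := fun h => hvw (by rw [Fin.ext h])
  rw [Fin.le_def] at hv1 hv2 hw1 hw2
  have hsz : s.val < z.val := by lia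
  let g : SimpleGraph.pathGraph (z - s + 1) ↪g SimpleGraph.pathGraph m :=
    { toFun := fun i => ⟨s + i, by lia⟩
      inj' := fun i i' h => by
        simp only [Fin.mk.injEq] at h
        ext
        lia
      map_rel_iff' := by
        intro i i'
        change (SimpleGraph.pathGraph m).Adj ⟨s + i, by lia⟩ ⟨s + i', by lia⟩ ↔ _
        simp only [SimpleGraph.pathGraph_adj]
        lia }
  have hg : ∀ i, (g i).val = s + i := fun i => rfl
  obtain ⟨J, hJ, b, len, φ, hφ⟩ := exists_legGraph_iso htree (N := z - s + 1) (by lia)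
    (f.comp g) (by
      intro x hx
      obtain ⟨i, rfl⟩ := hf hx
      have h1 := A.min'_le i ((hA i).2 hx)
      have h2 := A.le_max' i ((hA i).2 hx)
      rw [Fin.le_def] at h1 h2
      refine ⟨⟨i - s, by lia⟩, congrArg f (Fin.ext ?_)⟩
      change s.val + (i.val - s.val) = i.val
      lia)
  refine ⟨_, J, hJ, b, len, ⟨by lia, fun i hi => ?_⟩, ⟨φ⟩⟩
  refine exists_two_legs_of_inl_mem_hdv (len := len) hi ?_
  rw [← hφ, apply_mem_hdv_iff φ]
  change f (g i) ∈ hdv G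
  rcases hi with hi | hi
  · rw [show g i = s from Fin.ext (by rw [hg]; lia)]
    exact hmin
  · rw [show g i = z from Fin.ext (by rw [hg]; lia)]
    exact hmax

end extraction

/-! ### Codes and isomorphism classes -/

section codes

/-- The leg graph of a list `s` of multisets: the `i`-th vertex of the spine carries one leg with
`a + 1` vertices for each element `a` of the `i`-th multiset. -/
abbrev listGraph (s : List (Multiset ℕ)) :=
  legGraph (N := s.length) (J := Σ i : Fin s.length, (s.get i).ToType) Sigma.fst fun j => j.2.1

lemma legs_list (s : List (Multiset ℕ)) (i : Fin s.length) :
    legs (N := s.length) (J := Σ i : Fin s.length, (s.get i).ToType) Sigma.fst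
      (fun j => j.2.1) i = s.get i := by
  classical
  have h : (Finset.univ.filter fun j : Σ i : Fin s.length, (s.get i).ToType => j.1 = i) =
      Finset.univ.map (Function.Embedding.sigmaMk i) := by
    ext ⟨i', x⟩
    simp only [Finset.mem_filter, Finset.mem_univ, true_and, Finset.mem_map,
      Function.Embedding.sigmaMk_apply]
    constructor
    · rintro rfl
      exact ⟨x, rfl⟩
    · rintro ⟨y, hy⟩
      exact (congrArg Sigma.fst hy).symm
  rw [legs, h, Finset.map_val, Multiset.map_map]
  exact Multiset.map_univ_coe (s.get i)

lemma hasForks_iff {N : ℕ} {J : Type*} [Fintype J] (b : J → Fin N) (len : J → ℕ) :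
    HasForks b ↔
      2 ≤ N ∧ ∀ i : Fin N, i.val = 0 ∨ i.val + 1 = N → 2 ≤ (legs b len i).card := by
  refine and_congr_right fun _ => forall_congr' fun i => imp_congr_right fun _ => ?_
  rw [legs, Multiset.card_map, Finset.card_val]
  change _ ↔ 1 < _
  rw [Finset.one_lt_card_iff]
  constructor
  · rintro ⟨j, j', hne, h, h'⟩
    exact ⟨j, j', by simp [h], by simp [h'], hne⟩
  · rintro ⟨j, j', h, h', hne⟩
    exact ⟨j, j', hne, by simpa using h, by simpa using h'⟩

lemma nonempty_iso_listGraph_reverse (s : List (Multiset ℕ)) :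
    Nonempty (listGraph s ≃g listGraph s.reverse) := by
  have key : ∀ {N N' : ℕ} {J J' : Type} [Fintype J] [Fintype J'] (b : J → Fin N) (len : J → ℕ)
      (b' : J' → Fin N') (len' : J' → ℕ) (h : N = N')
      (_ : ∀ i, legs b len i = legs b' len' (Fin.cast h i.rev)),
      Nonempty (legGraph b len ≃g legGraph b' len') := by
    rintro N N' J J' _ _ b len b' len' rfl hl
    exact nonempty_iso_of_legs_eq_rev hl
  refine key _ _ _ _ (List.length_reverse).symm fun i => ?_
  rw [legs_list, legs_list, List.get_eq_getElem, List.get_eq_getElem, List.getElem_reverse]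
  congr 1
  simp only [Fin.val_cast, Fin.val_rev]
  lia

/-- A code of a tree: its legs at the vertices of the spine, listed along the spine, where both
ends carry at least two legs. -/
abbrev Code : Type :=
  {m : Multiset ℕ // 2 ≤ m.card} × List (Multiset ℕ) × {m : Multiset ℕ // 2 ≤ m.card}

/-- The legs of a code, as a list. -/
def Code.toList (c : Code) : List (Multiset ℕ) := c.1.1 :: (c.2.1 ++ [c.2.2.1])

/-- The code read from the other end of the spine. -/
def Code.rev (c : Code) : Code := (c.2.2, c.2.1.reverse, c.1)

lemma Code.rev_rev (c : Code) : c.rev.rev = c := by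
  simp [Code.rev]

lemma Code.toList_rev (c : Code) : c.rev.toList = c.toList.reverse := by
  simp [Code.rev, Code.toList]

lemma Code.toList_injective : Function.Injective Code.toList := by
  rintro ⟨a, l, a'⟩ ⟨c, m, c'⟩ h
  simp only [Code.toList, List.cons.injEq] at h
  obtain ⟨h1, h2⟩ := h
  have h3 := List.append_inj' h2 rfl
  rw [Prod.mk.injEq, Prod.mk.injEq]
  exact ⟨Subtype.ext h1, h3.1, Subtype.ext (List.singleton_inj.1 h3.2)⟩

lemma exists_toList_eq_iff (s : List (Multiset ℕ)) : (∃ c : Code, c.toList = s) ↔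
    2 ≤ s.length ∧ ∀ i : Fin s.length, i.val = 0 ∨ i.val + 1 = s.length →
      2 ≤ (s.get i).card := by
  constructor
  · rintro ⟨⟨a, l, a'⟩, rfl⟩
    refine ⟨by simp [Code.toList], ?_⟩
    rintro ⟨i, hi⟩ (h | h)
    · simp only at h
      subst h
      exact a.2
    · simp only [Code.toList, List.length_cons, List.length_append, List.length_nil] at h
      obtain rfl : i = l.length + 1 := by lia
      have h1 : (Code.toList (a, l, a')).get ⟨l.length + 1, hi⟩ = a'.1 := by
        simp [Code.toList]
      rw [h1]
      exact a'.2
  · rintro ⟨h2, h⟩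
    rcases s with _ | ⟨a, t⟩
    · simp at h2
    · rcases List.eq_nil_or_concat t with rfl | ⟨l, a', rfl⟩
      · simp at h2
      · refine ⟨(⟨a, h ⟨0, by simp⟩ (Or.inl rfl)⟩, l, ⟨a', ?_⟩), by simp [Code.toList]⟩
        have h1 := h ⟨l.length + 1, by simp⟩ (Or.inr (by simp))
        simpa using h1

lemma hasForks_toList (c : Code) :
    HasForks (N := c.toList.length) (J := Σ i : Fin c.toList.length, (c.toList.get i).ToType)
      Sigma.fst := by
  rw [hasForks_iff _ (fun j => j.2.1)]
  simp only [legs_list]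
  exact (exists_toList_eq_iff _).1 ⟨c, rfl⟩

lemma eq_or_eq_rev_of_iso {c c' : Code} (φ : listGraph c.toList ≃g listGraph c'.toList) :
    c' = c ∨ c' = c.rev := by
  obtain ⟨h, hl | hl⟩ := legs_eq_or_eq_rev_of_iso (hasForks_toList c) (hasForks_toList c') φ
  · left
    refine Code.toList_injective (List.ext_get h.symm fun k h1 h2 => ?_)
    have := hl ⟨k, h2⟩
    rwa [legs_list, legs_list] at this
  · right
    refine Code.toList_injective ?_
    rw [Code.toList_rev]
    refine List.ext_get (by rw [List.length_reverse, h]) fun k h1 h2 => ?_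
    have := hl ⟨k, h ▸ h1⟩
    rw [legs_list, legs_list] at this
    refine Eq.trans this ?_
    rw [List.get_eq_getElem, List.get_eq_getElem, List.getElem_reverse]
    congr 1
    simp only [Fin.val_rev]
    lia

lemma nonempty_iso_iff {c c' : Code} :
    Nonempty (listGraph c.toList ≃g listGraph c'.toList) ↔ c' = c ∨ c' = c.rev := by
  refine ⟨fun ⟨φ⟩ => eq_or_eq_rev_of_iso φ, ?_⟩
  rintro (rfl | rfl)
  · exact ⟨SimpleGraph.Iso.refl⟩
  · rw [Code.toList_rev]
    exact nonempty_iso_listGraph_reverse _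

/-- Every linear tree with at least two high degree vertices has a code. -/
lemma exists_code_iso {V : Type} [Finite V] {G : SimpleGraph V} (hG : IsLinearTree G)
    (hk : 2 ≤ (hdv G).ncard) : ∃ c : Code, Nonempty (G ≃g listGraph c.toList) := by
  obtain ⟨N, J, _, b, len, hb, ⟨φ⟩⟩ := exists_hasForks_iso hG hk
  obtain ⟨s, hs, hget⟩ : ∃ (s : List (Multiset ℕ)) (h : s.length = N),
      ∀ i : Fin s.length, s.get i = legs b len (Fin.cast h i) :=
    ⟨List.ofFn (legs b len), List.length_ofFn, fun i => List.get_ofFn _ i⟩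
  subst hs
  obtain ⟨ψ⟩ := nonempty_iso_of_legs_eq (b := b) (len := len)
    (b' := (Sigma.fst : (Σ i : Fin s.length, (s.get i).ToType) → _)) (len' := fun j => j.2.1)
    (funext fun i => (hget i).symm.trans (legs_list s i).symm)
  obtain ⟨c, rfl⟩ := (exists_toList_eq_iff s).2 (by
    rw [hasForks_iff b len] at hb
    refine ⟨hb.1, fun i hi => ?_⟩
    rw [hget]
    exact hb.2 i hi)
  exact ⟨c, ⟨φ.trans ψ⟩⟩

/-- The contribution of a vertex of the spine and of its legs to the number of vertices (exponent
of `x = X 0`) and to the number of high degree vertices (exponent of `y = X 1`) of the tree. -/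
noncomputable def weight (m : Multiset ℕ) : Fin 2 →₀ ℕ :=
  Finsupp.single 0 (1 + (m.sum + m.card)) + Finsupp.single 1 (if m = 0 then 0 else 1)

lemma weight_apply_zero (m : Multiset ℕ) : weight m 0 = 1 + (m.sum + m.card) := by
  simp [weight]

lemma weight_apply_one (m : Multiset ℕ) : weight m 1 = if m = 0 then 0 else 1 := by
  simp [weight]

/-- The weight of a code: the numbers of vertices and of high degree vertices of its tree. -/
noncomputable def Code.weight (c : Code) : Fin 2 →₀ ℕ := (c.toList.map LinearTrees.weight).sum

lemma Code.weight_rev (c : Code) : c.rev.weight = c.weight := by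
  rw [Code.weight, Code.weight, Code.toList_rev, List.map_reverse, List.sum_reverse]

lemma sum_map_apply {α : Type*} (w : α → Fin 2 →₀ ℕ) (l : List α) (i : Fin 2) :
    (l.map w).sum i = (l.map fun a => w a i).sum := by
  induction l with
  | nil => rfl
  | cons a l ih => simp [ih]

lemma card_listGraph (s : List (Multiset ℕ)) :
    Fintype.card (Fin s.length ⊕ Σ j : (Σ i : Fin s.length, (s.get i).ToType), Fin (j.2.1 + 1)) =
      (s.map weight).sum 0 := by
  have h : ∀ m : Multiset ℕ, ∑ x : m.ToType, (x.1 + 1) = m.sum + m.card := by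
    intro m
    have h1 := Multiset.map_univ m (fun a : ℕ => a + 1)
    have h2 : ∑ x : m.ToType, (x.1 + 1) = (m.map fun a => a + 1).sum := by
      rw [← h1]
      rfl
    rw [h2, Multiset.sum_map_add]
    simp
  rw [sum_map_apply, Fintype.card_sum, Fintype.card_fin, Fintype.card_sigma]
  simp only [Fintype.card_fin, weight_apply_zero]
  rw [Fintype.sum_sigma]
  simp only [h]
  rw [← Fin.sum_univ_fun_getElem]
  simp only [Finset.sum_add_distrib, Finset.sum_const, Finset.card_univ, Fintype.card_fin,
    smul_eq_mul, mul_one, List.get_eq_getElem]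

lemma ncard_hdv_listGraph (c : Code) : (hdv (listGraph c.toList)).ncard = c.weight 1 := by
  classical
  rw [(hasForks_toList c).hdv_legGraph, Set.ncard_image_of_injective _ Sum.inl_injective,
    Code.weight, sum_map_apply]
  simp only [weight_apply_one]
  generalize c.toList = s
  have h : Set.range (Sigma.fst : (Σ i : Fin s.length, (s.get i).ToType) → Fin s.length) =
      ↑(Finset.univ.filter fun i : Fin s.length => s.get i ≠ 0) := by
    ext i
    simp only [Set.mem_range, Finset.coe_filter, Finset.mem_univ, true_and, Set.mem_ofPred_eq]
    constructor
    · rintro ⟨⟨i, x⟩, rfl⟩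
      exact fun h0 => Multiset.notMem_zero x.1
        (h0 ▸ Multiset.coe_mem (x := x) : x.1 ∈ (0 : Multiset ℕ))
    · intro h0
      obtain ⟨a, ha⟩ := Multiset.exists_mem_of_ne_zero h0
      exact ⟨⟨i, ⟨a, ⟨0, Multiset.count_pos.2 ha⟩⟩⟩, rfl⟩
  rw [h, Set.ncard_coe_finset, Finset.card_filter, ← Fin.sum_univ_fun_getElem]
  refine Finset.sum_congr rfl fun i _ => ?_
  simp only [List.get_eq_getElem, ne_eq, ite_not]

lemma isKLinearTree_listGraph (c : Code) : IsKLinearTree (c.weight 1) (listGraph c.toList) :=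
  ⟨(hasForks_toList c).isLinearTree_legGraph _, ncard_hdv_listGraph c⟩

/-- If the fibres of `Φ` are the orbits of an involution `ρ`, then the number of values of `Φ` is
the average of the numbers of all points and of fixed points of `ρ`. -/
lemma two_mul_ncard_range {X Y : Type*} [Finite X] {ρ : X → X} (hρ : ∀ x, ρ (ρ x) = x)
    {Φ : X → Y} (hΦ : ∀ x x', Φ x = Φ x' ↔ x' = x ∨ x' = ρ x) :
    2 * (Set.range Φ).ncard = Nat.card X + Nat.card {x // ρ x = x} := by
  classical
  have := Fintype.ofFinite X
  rw [Nat.card_eq_fintype_card, Nat.card_eq_fintype_card, Fintype.card_subtype,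
    Finset.card_filter, ← Finset.card_univ, Finset.card_eq_sum_ones, ← Finset.sum_add_distrib,
    ← Finset.sum_fiberwise_of_maps_to (t := Finset.univ.image Φ) (g := Φ)
      (fun x hx => Finset.mem_image_of_mem _ hx)]
  have hfib : ∀ y ∈ Finset.univ.image Φ,
      ∑ x ∈ Finset.univ.filter (fun x => Φ x = y), (1 + if ρ x = x then 1 else 0) = 2 := by
    intro y hy
    obtain ⟨x, -, rfl⟩ := Finset.mem_image.1 hy
    have h : Finset.univ.filter (fun x' => Φ x' = Φ x) = {x, ρ x} := by
      ext x'
      simp only [Finset.mem_filter, Finset.mem_univ, true_and, Finset.mem_insert,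
        Finset.mem_singleton]
      rw [eq_comm, hΦ]
    rw [h]
    by_cases hx : ρ x = x
    · rw [hx, Finset.pair_eq_singleton, Finset.sum_singleton, if_pos hx]
    · rw [Finset.sum_pair (Ne.symm hx), if_neg hx, hρ, if_neg (Ne.symm hx)]
  rw [Finset.sum_congr rfl hfib, Finset.sum_const, smul_eq_mul, mul_comm, ← Set.image_univ,
    ← Finset.coe_univ, ← Finset.coe_image, Set.ncard_coe_finset]

/-- Isomorphism classes of linear trees correspond to codes up to reversal. -/
theorem two_mul_numKLinearTrees (e : Fin 2 →₀ ℕ) (he : 2 ≤ e 1)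
    [Finite {c : Code // c.weight = e}] :
    2 * numKLinearTrees (e 0) (e 1) = Nat.card {c : Code // c.weight = e} +
      Nat.card {c : Code // c.rev = c ∧ c.weight = e} := by
  classical
  have hcard : ∀ c : {c : Code // c.weight = e}, Fintype.card (Fin c.1.toList.length ⊕
      Σ j : (Σ i : Fin c.1.toList.length, (c.1.toList.get i).ToType), Fin (j.2.1 + 1)) = e 0 := by
    rintro ⟨c, rfl⟩
    exact card_listGraph _
  let Φ : {c : Code // c.weight = e} → Quotient (isoSetoid (e 0)) := fun c =>
    Quotient.mk _ ((listGraph c.1.toList).overFin (hcard c))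
  have hiso : ∀ c, Nonempty (listGraph c.1.toList ≃g
      (listGraph c.1.toList).overFin (hcard c)) := fun c =>
    ⟨(listGraph c.1.toList).overFinIso (hcard c)⟩
  have hrange : Set.range Φ =
      Quotient.mk (isoSetoid (e 0)) '' {G | IsKLinearTree (e 1) G} := by
    ext q
    constructor
    · rintro ⟨c, rfl⟩
      obtain ⟨φ⟩ := hiso c
      refine ⟨_, ?_, rfl⟩
      have := (isKLinearTree_listGraph c.1).of_iso φ
      rwa [c.2] at this
    · rintro ⟨G, hG, rfl⟩
      have hG' : IsKLinearTree (e 1) G := hG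
      obtain ⟨c, ⟨φ⟩⟩ := exists_code_iso hG'.1 (by rw [hG'.2]; exact he)
      have h1 : c.weight 1 = e 1 := by
        rw [← ncard_hdv_listGraph, ← (hG'.of_iso φ).2]
      have h0 : c.weight 0 = e 0 := by
        rw [Code.weight, ← card_listGraph, ← Fintype.card_congr φ.toEquiv, Fintype.card_fin]
      have hw : c.weight = e := by
        ext i
        fin_cases i
        · exact h0
        · exact h1
      obtain ⟨ψ⟩ := hiso ⟨c, hw⟩
      exact ⟨⟨c, hw⟩, Quotient.sound ⟨(φ.trans ψ).symm⟩⟩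
  have hΦ : ∀ c c' : {c : Code // c.weight = e}, Φ c = Φ c' ↔
      c' = c ∨ c' = ⟨c.1.rev, c.1.weight_rev.trans c.2⟩ := by
    intro c c'
    obtain ⟨φ⟩ := hiso c
    obtain ⟨φ'⟩ := hiso c'
    rw [Subtype.ext_iff, Subtype.ext_iff, ← nonempty_iso_iff]
    constructor
    · intro h
      obtain ⟨ψ⟩ := Quotient.exact h
      exact ⟨(φ.trans ψ).trans φ'.symm⟩
    · rintro ⟨ψ⟩
      exact Quotient.sound ⟨(φ.symm.trans ψ).trans φ'⟩
  rw [numKLinearTrees, ← hrange, two_mul_ncard_range (fun c => Subtype.ext c.1.rev_rev) hΦ]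
  congr 1
  refine Nat.card_congr ⟨fun c => ⟨c.1.1, congrArg Subtype.val c.2, c.1.2⟩,
    fun c => ⟨⟨c.1, c.2.2⟩, Subtype.ext c.2.1⟩, fun _ => rfl, fun _ => rfl⟩

end codes

/-! ### Generating functions of weighted types -/

section generatingFunctions

open MvPowerSeries

/-- The generating function of a type whose elements are weighted by exponents. It is meaningful
when every weight is attained finitely often. -/
noncomputable def gf {α : Type*} (w : α → Fin 2 →₀ ℕ) : MvPowerSeries (Fin 2) ℚ :=
  fun e => (Nat.card {a // w a = e} : ℚ)

/-- Every weight is attained finitely often. -/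
def FiniteFibers {α : Type*} (w : α → Fin 2 →₀ ℕ) : Prop := ∀ e, Finite {a // w a = e}

variable {α β : Type*} {w : α → Fin 2 →₀ ℕ} {w' : β → Fin 2 →₀ ℕ}

lemma coeff_gf (w : α → Fin 2 →₀ ℕ) (e : Fin 2 →₀ ℕ) :
    coeff e (gf w) = Nat.card {a // w a = e} := rfl

lemma gf_congr (f : α ≃ β) (h : ∀ a, w' (f a) = w a) : gf w = gf w' := by
  ext e
  rw [coeff_gf, coeff_gf]
  exact congrArg _ (Nat.card_congr (f.subtypeEquiv fun a => by rw [h]))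

lemma FiniteFibers.of_injective (hw' : FiniteFibers w') (f : α → β) (hf : Function.Injective f)
    (g : (Fin 2 →₀ ℕ) → Fin 2 →₀ ℕ) (h : ∀ a, w' (f a) = g (w a)) : FiniteFibers w := fun e =>
  have := hw' (g e)
  Finite.of_injective
    (fun a : {a // w a = e} => (⟨f a, (h a).trans (congrArg g a.2)⟩ : {b // w' b = g e}))
    fun _ _ hab => Subtype.ext (hf (congrArg (fun b : {b // w' b = g e} => b.1) hab))

lemma FiniteFibers.subtype (hw : FiniteFibers w) (p : α → Prop) :
    FiniteFibers fun a : {a // p a} => w a :=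
  hw.of_injective _ Subtype.val_injective id fun _ => rfl

lemma FiniteFibers.of_finite [Finite α] (w : α → Fin 2 →₀ ℕ) : FiniteFibers w :=
  fun _ => inferInstance

lemma gf_unit (c : Fin 2 →₀ ℕ) : gf (fun _ : Unit => c) = monomial c 1 := by
  classical
  ext e
  rw [coeff_gf, coeff_monomial]
  split_ifs with h
  · subst h
    simp
  · have : IsEmpty {_a : Unit // c = e} := ⟨fun a => h a.2.symm⟩
    simp

lemma gf_eq_add_subtype (hw : FiniteFibers w) (p : α → Prop) :
    gf w = gf (fun a : {a // p a} => w a) + gf (fun a : {a // ¬ p a} => w a) := by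
  classical
  ext e
  have := hw e
  have h1 := hw.subtype p e
  have h2 := hw.subtype (fun a => ¬ p a) e
  rw [map_add, coeff_gf, coeff_gf, coeff_gf, ← Nat.cast_add, ← Nat.card_sum]
  refine congrArg _ (Nat.card_congr ?_)
  refine (Equiv.sumCompl fun a : {a // w a = e} => p a).symm.trans (Equiv.sumCongr ?_ ?_)
  · exact ⟨fun a => ⟨⟨a.1.1, a.2⟩, a.1.2⟩, fun a => ⟨⟨a.1.1, a.2⟩, a.1.2⟩, fun _ => rfl,
      fun _ => rfl⟩
  · exact ⟨fun a => ⟨⟨a.1.1, a.2⟩, a.1.2⟩, fun a => ⟨⟨a.1.1, a.2⟩, a.1.2⟩, fun _ => rfl,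
      fun _ => rfl⟩

/-- A pair of total weight `e` is a splitting of `e` together with elements of these weights. -/
def prodFiberEquiv (w : α → Fin 2 →₀ ℕ) (w' : β → Fin 2 →₀ ℕ) (e : Fin 2 →₀ ℕ) :
    {x : α × β // w x.1 + w' x.2 = e} ≃
      Σ q : Finset.HasAntidiagonal.antidiagonal e, {a // w a = q.1.1} × {b // w' b = q.1.2} where
  toFun x := ⟨⟨(w x.1.1, w' x.1.2), Finset.HasAntidiagonal.mem_antidiagonal.2 x.2⟩,
    ⟨x.1.1, rfl⟩, ⟨x.1.2, rfl⟩⟩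
  invFun y := ⟨(y.2.1.1, y.2.2.1), by
    rw [y.2.1.2, y.2.2.2]
    exact Finset.HasAntidiagonal.mem_antidiagonal.1 y.1.2⟩
  left_inv _ := rfl
  right_inv := by
    rintro ⟨⟨⟨q, q'⟩, hq⟩, ⟨a, (rfl : w a = q)⟩, ⟨b, (rfl : w' b = q')⟩⟩
    rfl

lemma FiniteFibers.prod (hw : FiniteFibers w) (hw' : FiniteFibers w') :
    FiniteFibers fun x : α × β => w x.1 + w' x.2 := fun e =>
  have : ∀ q : Finset.HasAntidiagonal.antidiagonal e,
      Finite ({a // w a = q.1.1} × {b // w' b = q.1.2}) :=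
    fun q => have := hw q.1.1; have := hw' q.1.2; inferInstance
  Finite.of_equiv _ (prodFiberEquiv w w' e).symm

lemma gf_prod (hw : FiniteFibers w) (hw' : FiniteFibers w') :
    gf (fun x : α × β => w x.1 + w' x.2) = gf w * gf w' := by
  classical
  ext e
  have : ∀ q : Finset.HasAntidiagonal.antidiagonal e,
      Finite ({a // w a = q.1.1} × {b // w' b = q.1.2}) :=
    fun q => have := hw q.1.1; have := hw' q.1.2; inferInstance
  rw [coeff_gf, coeff_mul, Nat.card_congr (prodFiberEquiv w w' e), Nat.card_sigma,
    ← Finset.sum_coe_sort (Finset.HasAntidiagonal.antidiagonal e)]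
  push_cast
  refine Finset.sum_congr rfl fun q _ => ?_
  rw [Nat.card_prod, coeff_gf, coeff_gf, Nat.cast_mul]

lemma gf_const_add (c : Fin 2 →₀ ℕ) (hw : FiniteFibers w) :
    gf (fun a => c + w a) = monomial c 1 * gf w := by
  rw [← gf_unit, ← gf_prod (FiniteFibers.of_finite _) hw]
  exact gf_congr (Equiv.punitProd α).symm fun _ => rfl

/-- The weight of a list. -/
noncomputable def listWeight (w : α → Fin 2 →₀ ℕ) (l : List α) : Fin 2 →₀ ℕ := (l.map w).sum

/-- A nonempty list consists of a head and a tail. -/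
def listEquiv (α : Type*) : {l : List α // ¬ l = []} ≃ α × List α where
  toFun l := (l.1.head l.2, l.1.tail)
  invFun x := ⟨x.1 :: x.2, by simp⟩
  left_inv l := Subtype.ext (List.cons_head_tail l.2)
  right_inv _ := rfl

lemma listWeight_listEquiv (l : {l : List α // ¬ l = []}) :
    w (listEquiv α l).1 + listWeight w (listEquiv α l).2 = listWeight w l := by
  obtain ⟨_ | ⟨a, l⟩, h⟩ := l
  · exact absurd rfl h
  · rfl

lemma FiniteFibers.list (hw : FiniteFibers w) (hpos : ∀ a, 0 < w a 0) :
    FiniteFibers (listWeight w) := by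
  have key : ∀ n e, e 0 = n → Finite {l : List α // listWeight w l = e} := by
    intro n
    induction n using Nat.strong_induction_on with
    | _ n ih =>
      intro e he
      -- only lists of weight smaller than `e` occur as tails
      let w₁ : α × List α → Fin 2 →₀ ℕ := fun x => w x.1 + listWeight w x.2
      have h1 : Finite {x : α × List α // w₁ x = e} := by
        have : ∀ q : Finset.HasAntidiagonal.antidiagonal e,
            Finite ({a // w a = q.1.1} × {l : List α // listWeight w l = q.1.2}) := by
          intro q
          have := hw q.1.1
          rcases isEmpty_or_nonempty {a // w a = q.1.1} with hemp | ⟨⟨a⟩⟩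
          · infer_instance
          · have h2 := hpos a
            rw [a.2] at h2
            have h3 : q.1.1 0 + q.1.2 0 = e 0 := by
              rw [← Finsupp.add_apply, Finset.HasAntidiagonal.mem_antidiagonal.1 q.2]
            have := ih (q.1.2 0) (by lia) q.1.2 rfl
            infer_instance
        exact Finite.of_equiv _ (prodFiberEquiv w (listWeight w) e).symm
      refine Finite.of_injective (β := Option {x : α × List α // w₁ x = e})
        (fun l => if h : l.1 = [] then none else
          some ⟨listEquiv α ⟨l.1, h⟩, (listWeight_listEquiv ⟨l.1, h⟩).trans l.2⟩) ?_
      rintro ⟨l, hl⟩ ⟨l', hl'⟩ h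
      refine Subtype.ext ?_
      by_cases h1 : l = [] <;> by_cases h2 : l' = []
      · exact h1.trans h2.symm
      · simp [h1, h2] at h
      · simp [h1, h2] at h
      · simp only [h1, h2, dite_false, Option.some.injEq, Subtype.mk.injEq] at h
        exact congrArg (fun l : {l : List α // ¬ l = []} => l.1) ((listEquiv α).injective h)
  exact fun e => key _ e rfl

lemma gf_list (hw : FiniteFibers w) (hpos : ∀ a, 0 < w a 0) :
    gf (listWeight w) * (1 - gf w) = 1 := by
  have hl := hw.list hpos
  have h1 := gf_eq_add_subtype hl (fun l => l = [])
  have h2 : gf (fun l : {l : List α // ¬ l = []} => listWeight w l) =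
      gf w * gf (listWeight w) := by
    rw [← gf_prod hw hl]
    exact gf_congr (listEquiv α) listWeight_listEquiv
  have h3 : gf (fun l : {l : List α // l = []} => listWeight w l) = 1 := by
    rw [← monomial_zero_one, ← gf_unit]
    refine gf_congr ⟨fun _ => (), fun _ => ⟨[], rfl⟩, ?_, fun _ => rfl⟩ ?_
    · rintro ⟨l, rfl⟩
      rfl
    · rintro ⟨l, rfl⟩
      rfl
  rw [h2, h3] at h1
  linear_combination h1

end generatingFunctions

/-! ### Legs and partitions -/

section partitions

open MvPowerSeries

/-- The number of vertices of the legs encoded by `m`. -/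
def size (m : Multiset ℕ) : ℕ := m.sum + m.card

lemma sum_map_succ (m : Multiset ℕ) : (m.map Nat.succ).sum = size m := by
  have h : m.map Nat.succ = m.map fun a => a + 1 := rfl
  rw [h, Multiset.sum_map_add]
  simp [size]

/-- Partitions of `n` are legs with `n` vertices in total. -/
def sizeFiberEquiv (n : ℕ) : {m : Multiset ℕ // size m = n} ≃ Nat.Partition n where
  toFun m := ⟨m.1.map Nat.succ, by
    intro i hi
    obtain ⟨a, -, rfl⟩ := Multiset.mem_map.1 hi
    exact Nat.succ_pos a, by rw [sum_map_succ, m.2]⟩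
  invFun q := ⟨q.parts.map Nat.pred, by
    rw [← sum_map_succ, Multiset.map_map]
    refine Eq.trans (congrArg _ ?_) q.parts_sum
    refine (Multiset.map_congr rfl fun a ha => ?_).trans (Multiset.map_id _)
    exact Nat.succ_pred_eq_of_pos (q.parts_pos ha)⟩
  left_inv m := Subtype.ext (by
    simp only [Multiset.map_map]
    exact (Multiset.map_congr rfl fun a _ => Nat.pred_succ a).trans (Multiset.map_id _))
  right_inv q := Nat.Partition.ext (by
    simp only [Multiset.map_map]
    refine (Multiset.map_congr rfl fun a ha => ?_).trans (Multiset.map_id _)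
    exact Nat.succ_pred_eq_of_pos (q.parts_pos ha))

variable {d : ℕ}

lemma single_eq_single_mul_iff (hd : 0 < d) (a n : ℕ) :
    (Finsupp.single (0 : Fin 2) (d * a) = Finsupp.single 0 (d * n)) ↔ a = n := by
  rw [(Finsupp.single_injective 0).eq_iff, Nat.mul_left_cancel_iff hd]

lemma finiteFibers_size (hd : 0 < d) :
    FiniteFibers fun m : Multiset ℕ => Finsupp.single 0 (d * size m) := by
  intro e
  have : Finite {m : Multiset ℕ // size m = e 0 / d} := Finite.of_equiv _ (sizeFiberEquiv _).symm
  have h : ∀ m : {m : Multiset ℕ // Finsupp.single 0 (d * size m) = e}, size m.1 = e 0 / d := by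
    rintro ⟨m, rfl⟩
    rw [Finsupp.single_eq_same, Nat.mul_div_cancel_left _ hd]
  exact Finite.of_injective (fun m => (⟨m.1, h m⟩ : {m : Multiset ℕ // size m = e 0 / d}))
    fun _ _ h => Subtype.ext
      (congrArg (fun m : {m : Multiset ℕ // size m = e 0 / d} => m.1) h)

lemma gf_size (hd : 0 < d) : gf (fun m : Multiset ℕ => Finsupp.single 0 (d * size m)) =
    partitionGF.subst (X 0 ^ d : MvPowerSeries (Fin 2) ℚ) := by
  classical
  have hsub : PowerSeries.HasSubst (X 0 ^ d : MvPowerSeries (Fin 2) ℚ) :=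
    PowerSeries.HasSubst.of_constantCoeff_zero (by simp [hd.ne'])
  ext e
  rw [coeff_gf, PowerSeries.coeff_subst hsub]
  have hpow : ∀ n : ℕ, coeff e ((X 0 ^ d : MvPowerSeries (Fin 2) ℚ) ^ n) =
      if e = Finsupp.single 0 (d * n) then 1 else 0 := by
    intro n
    rw [← pow_mul, coeff_X_pow]
  simp only [hpow]
  by_cases he : ∃ n, e = Finsupp.single 0 (d * n)
  · obtain ⟨n, rfl⟩ := he
    rw [finsum_eq_single _ n]
    · rw [if_pos rfl, partitionGF, PowerSeries.coeff_mk, smul_eq_mul, mul_one,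
        ← Nat.card_eq_fintype_card]
      refine congrArg _ (Nat.card_congr (Equiv.trans ?_ (sizeFiberEquiv n)))
      exact Equiv.subtypeEquivRight fun m => single_eq_single_mul_iff hd _ _
    · intro k hk
      rw [if_neg, smul_zero]
      rw [single_eq_single_mul_iff hd]
      exact hk.symm
  · have : IsEmpty {m : Multiset ℕ // Finsupp.single 0 (d * size m) = e} :=
      ⟨fun m => he ⟨_, m.2.symm⟩⟩
    rw [Nat.card_of_isEmpty, Nat.cast_zero, eq_comm]
    refine finsum_eq_zero_of_forall_eq_zero fun n => ?_
    rw [if_neg fun h => he ⟨n, h⟩, smul_zero]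

lemma monomial_single_zero (n : ℕ) :
    (monomial (Finsupp.single 0 n) 1 : MvPowerSeries (Fin 2) ℚ) = X 0 ^ n := by
  rw [X_pow_eq]

/-- There is exactly one way to have at most one leg with `n` vertices in total. -/
lemma size_bijective : Function.Bijective fun m : {m : Multiset ℕ // ¬ 2 ≤ m.card} => size m := by
  constructor
  · rintro ⟨m, hm⟩ ⟨m', hm'⟩ h
    refine Subtype.ext ?_
    simp only [size] at h
    rcases (by lia : m.card = 0 ∨ m.card = 1) with h0 | h1
    · rw [Multiset.card_eq_zero] at h0
      subst h0
      simp only [Multiset.sum_zero, Multiset.card_zero] at h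
      exact (Multiset.card_eq_zero.1 (by lia)).symm
    · obtain ⟨a, rfl⟩ := Multiset.card_eq_one.1 h1
      rcases (by lia : m'.card = 0 ∨ m'.card = 1) with h0' | h1'
      · rw [Multiset.card_eq_zero] at h0'
        subst h0'
        simp at h
      · obtain ⟨a', rfl⟩ := Multiset.card_eq_one.1 h1'
        simp only [Multiset.sum_singleton, Multiset.card_singleton] at h
        simp only
        congr 1
        lia
  · intro n
    rcases n with _ | n
    · exact ⟨⟨0, by simp⟩, rfl⟩
    · exact ⟨⟨{n}, by simp⟩, by simp [size]⟩

lemma one_sub_X_pow_constantCoeff (hd : 0 < d) :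
    constantCoeff (1 - X 0 ^ d : MvPowerSeries (Fin 2) ℚ) ≠ 0 := by
  simp [hd.ne']

lemma gf_at_most_one_leg (hd : 0 < d) :
    gf (fun m : {m : Multiset ℕ // ¬ 2 ≤ m.card} => Finsupp.single 0 (d * size m)) =
      (1 - X 0 ^ d : MvPowerSeries (Fin 2) ℚ)⁻¹ := by
  have h := gf_list (w := fun _ : Unit => Finsupp.single 0 d) (FiniteFibers.of_finite _)
    (fun _ => by simpa using hd)
  rw [gf_unit, monomial_single_zero] at h
  rw [← (MvPowerSeries.eq_inv_iff_mul_eq_one (one_sub_X_pow_constantCoeff hd)).2 h]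
  refine gf_congr ((Equiv.ofBijective _ size_bijective).trans
    (Equiv.listUniqueEquiv Unit).symm) fun m => ?_
  simp [listWeight, Equiv.listUniqueEquiv, mul_comm]

/-- The generating function of the legs at an end of the spine: partitions with at least two
parts. -/
lemma gf_fork_size (hd : 0 < d) :
    gf (fun m : {m : Multiset ℕ // 2 ≤ m.card} => Finsupp.single 0 (d * size m)) =
      partitionGF.subst (X 0 ^ d : MvPowerSeries (Fin 2) ℚ) - (1 - X 0 ^ d)⁻¹ := by
  rw [← gf_size hd, ← gf_at_most_one_leg hd,
    gf_eq_add_subtype (finiteFibers_size hd) (fun m => 2 ≤ m.card)]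
  ring

lemma smul_weight_of_ne_zero {m : Multiset ℕ} (hm : m ≠ 0) :
    d • weight m =
      (Finsupp.single 0 d + Finsupp.single 1 d) + Finsupp.single 0 (d * size m) := by
  ext i
  fin_cases i
  · simp [weight_apply_zero, size, mul_add]
  · simp [weight_apply_one, hm]

lemma smul_weight_zero : d • weight 0 = Finsupp.single 0 d := by
  ext i
  fin_cases i
  · simp [weight_apply_zero]
  · simp [weight_apply_one]

lemma finiteFibers_smul_weight (hd : 0 < d) : FiniteFibers fun m : Multiset ℕ => d • weight m :=
  (finiteFibers_size hd).of_injective id Function.injective_id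
    (fun e => Finsupp.single 0 (e 0 - d)) fun m => by simp [weight_apply_zero, size, mul_add]

lemma monomial_corner : (monomial (Finsupp.single 0 d + Finsupp.single 1 d) 1 :
    MvPowerSeries (Fin 2) ℚ) = X 0 ^ d * X 1 ^ d := by
  rw [X_pow_eq, X_pow_eq, monomial_mul_monomial, one_mul]

lemma gf_fork (hd : 0 < d) :
    gf (fun m : {m : Multiset ℕ // 2 ≤ m.card} => d • weight m) =
      X 0 ^ d * X 1 ^ d *
        (partitionGF.subst (X 0 ^ d : MvPowerSeries (Fin 2) ℚ) - (1 - X 0 ^ d)⁻¹) := by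
  rw [← gf_fork_size hd, ← monomial_corner,
    ← gf_const_add _ ((finiteFibers_size hd).subtype _)]
  congr 1
  funext m
  refine smul_weight_of_ne_zero fun h => ?_
  have := m.2
  rw [h] at this
  simp at this

/-- The generating function of an inner vertex of the spine with its legs. -/
lemma gf_smul_weight (hd : 0 < d) : gf (fun m : Multiset ℕ => d • weight m) =
    X 0 ^ d * (1 + X 1 ^ d *
      (partitionGF.subst (X 0 ^ d : MvPowerSeries (Fin 2) ℚ) - 1)) := by
  have hzero : ∀ (w : Multiset ℕ → Fin 2 →₀ ℕ),
      gf (fun m : {m : Multiset ℕ // m = 0} => w m) = monomial (w 0) 1 := by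
    intro w
    rw [← gf_unit]
    refine gf_congr ⟨fun _ => (), fun _ => ⟨0, rfl⟩, ?_, fun _ => rfl⟩ ?_
    · rintro ⟨l, rfl⟩
      rfl
    · rintro ⟨l, rfl⟩
      rfl
  have h1 := gf_eq_add_subtype (finiteFibers_size hd) (fun m => m = 0)
  have h2 := gf_eq_add_subtype (finiteFibers_smul_weight hd) (fun m => m = 0)
  have h3 : gf (fun m : {m : Multiset ℕ // ¬ m = 0} => d • weight m) =
      X 0 ^ d * X 1 ^ d *
        gf (fun m : {m : Multiset ℕ // ¬ m = 0} => Finsupp.single 0 (d * size m)) := by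
    rw [← monomial_corner, ← gf_const_add _ ((finiteFibers_size hd).subtype _)]
    congr 1
    funext m
    exact smul_weight_of_ne_zero m.2
  have h4 : size 0 = 0 := rfl
  rw [hzero fun m => Finsupp.single 0 (d * size m), h4, mul_zero, Finsupp.single_zero,
    monomial_zero_one, gf_size hd] at h1
  rw [hzero fun m => d • weight m, smul_weight_zero, monomial_single_zero, h3] at h2
  rw [h2]
  linear_combination (-(X 0 ^ d * X 1 ^ d) : MvPowerSeries (Fin 2) ℚ) * h1

end partitions

/-! ### Palindromic codes -/

section palindromes

/-- A palindrome is determined by its first half and its middle term, if there is one. -/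
def ofHalf {α : Type*} (x : List α × Option α) : List α :=
  x.1 ++ (x.2.toList ++ x.1.reverse)

lemma reverse_ofHalf {α : Type*} (x : List α × Option α) : (ofHalf x).reverse = ofHalf x := by
  obtain ⟨m, _ | a⟩ := x <;> simp [ofHalf]

lemma ofHalf_injective {α : Type*} : Function.Injective (ofHalf (α := α)) := by
  rintro ⟨m, o⟩ ⟨m', o'⟩ h
  have hlen := congrArg List.length h
  have ho : ∀ o : Option α, o.toList.length ≤ 1 := by rintro (_ | a) <;> simp
  have h1 := ho o
  have h2 := ho o'
  simp only [ofHalf, List.length_append, List.length_reverse] at hlen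
  obtain ⟨rfl, h3⟩ := List.append_inj h (by simp only; lia)
  have h4 := List.append_cancel_right h3
  simp only at h4
  rw [Prod.mk.injEq]
  refine ⟨rfl, ?_⟩
  rcases o with _ | a <;> rcases o' with _ | a' <;> simp_all

lemma exists_ofHalf {α : Type*} {l : List α} (h : l.Palindrome) : ∃ x, ofHalf x = l := by
  induction h with
  | nil => exact ⟨([], none), rfl⟩
  | singleton a => exact ⟨([], some a), rfl⟩
  | @cons_concat a l _ ih =>
    obtain ⟨⟨m, o⟩, rfl⟩ := ih
    exact ⟨(a :: m, o), by simp [ofHalf]⟩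

/-- The code with first half `x.2` of its inner legs, and with legs `x.1` at both ends. -/
def palindromicCode
    (x : {m : Multiset ℕ // 2 ≤ m.card} × List (Multiset ℕ) × Option (Multiset ℕ)) :
    {c : Code // c.rev = c} :=
  ⟨(x.1, ofHalf x.2, x.1), by rw [Code.rev, reverse_ofHalf]⟩

lemma palindromicCode_bijective : Function.Bijective palindromicCode := by
  constructor
  · rintro ⟨a, x⟩ ⟨a', x'⟩ h
    have h1 : ((a, ofHalf x, a) : Code) = (a', ofHalf x', a') :=
      congrArg (fun c : {c : Code // c.rev = c} => c.1) h
    rw [Prod.mk.injEq, Prod.mk.injEq] at h1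
    rw [Prod.mk.injEq]
    exact ⟨h1.1, ofHalf_injective h1.2.1⟩
  · rintro ⟨⟨a, l, a'⟩, h⟩
    simp only [Code.rev, Prod.mk.injEq] at h
    obtain ⟨rfl, hl, -⟩ := h
    obtain ⟨x, rfl⟩ := exists_ofHalf (List.Palindrome.of_reverse_eq hl)
    exact ⟨(a', x), rfl⟩

lemma Code.weight_eq (c : Code) : c.weight =
    LinearTrees.weight c.1.1 + (listWeight LinearTrees.weight c.2.1 +
      LinearTrees.weight c.2.2.1) := by
  simp [Code.weight, Code.toList, listWeight]

/-- The weight of an optional multiset: `none` has weight zero. -/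
noncomputable def optionWeight (o : Option (Multiset ℕ)) : Fin 2 →₀ ℕ := o.elim 0 weight

lemma listWeight_smul (d : ℕ) (l : List (Multiset ℕ)) :
    listWeight (fun m => d • weight m) l = d • listWeight weight l := by
  simp [listWeight, List.smul_sum, Function.comp_def]

lemma weight_palindromicCode
    (x : {m : Multiset ℕ // 2 ≤ m.card} × List (Multiset ℕ) × Option (Multiset ℕ)) :
    (palindromicCode x).1.weight = 2 • weight x.1 +
      (listWeight (fun m => 2 • weight m) x.2.1 + optionWeight x.2.2) := by
  obtain ⟨a, l, o⟩ := x
  rw [Code.weight_eq, listWeight_smul]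
  have h : listWeight weight (ofHalf (l, o)) =
      listWeight weight l + (optionWeight o + listWeight weight l) := by
    rcases o with _ | m <;>
      simp [listWeight, ofHalf, optionWeight, List.sum_reverse, List.map_reverse]
  change weight a.1 + (listWeight weight (ofHalf (l, o)) + weight a.1) = _
  rw [h]
  simp only [two_smul]
  abel

end palindromes

/-! ### Counting the codes -/

section main

open MvPowerSeries

lemma smul_weight_pos {d : ℕ} (hd : 0 < d) (m : Multiset ℕ) : 0 < (d • weight m) 0 := by
  simp only [Finsupp.smul_apply, weight_apply_zero, smul_eq_mul]
  positivity

lemma finiteFibers_listWeight {d : ℕ} (hd : 0 < d) :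
    FiniteFibers (listWeight fun m => d • weight m) :=
  (finiteFibers_smul_weight hd).list (smul_weight_pos hd)

lemma finiteFibers_fork {d : ℕ} (hd : 0 < d) :
    FiniteFibers fun m : {m : Multiset ℕ // 2 ≤ m.card} => d • weight m :=
  (finiteFibers_smul_weight hd).subtype _

lemma code_weight_eq : Code.weight = fun c : Code => 1 • weight c.1.1 +
    (listWeight (fun m => 1 • weight m) c.2.1 + 1 • weight c.2.2.1) := by
  funext c
  rw [Code.weight_eq]
  simp only [one_smul]

lemma finiteFibers_code : FiniteFibers Code.weight := by
  rw [code_weight_eq]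
  exact (finiteFibers_fork one_pos).prod
    ((finiteFibers_listWeight one_pos).prod (finiteFibers_fork one_pos))

lemma gf_code : gf Code.weight =
    gf (fun m : {m : Multiset ℕ // 2 ≤ m.card} => 1 • weight m) *
      (gf (listWeight fun m => 1 • weight m) *
        gf (fun m : {m : Multiset ℕ // 2 ≤ m.card} => 1 • weight m)) := by
  rw [code_weight_eq, gf_prod (finiteFibers_fork one_pos)
    ((finiteFibers_listWeight one_pos).prod (finiteFibers_fork one_pos)),
    gf_prod (finiteFibers_listWeight one_pos) (finiteFibers_fork one_pos)]

lemma finiteFibers_optionWeight : FiniteFibers optionWeight := by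
  refine (finiteFibers_listWeight one_pos).of_injective Option.toList
    (fun o o' h => ?_) id fun o => ?_
  · rcases o with _ | m <;> rcases o' with _ | m' <;> simp_all
  · rcases o with _ | m <;> simp [listWeight, optionWeight]

lemma gf_optionWeight : gf optionWeight = 1 + gf (fun m : Multiset ℕ => 1 • weight m) := by
  rw [gf_eq_add_subtype finiteFibers_optionWeight (fun o => o = none)]
  congr 1
  · rw [← monomial_zero_one, ← gf_unit]
    refine gf_congr ⟨fun _ => (), fun _ => ⟨none, rfl⟩, ?_, fun _ => rfl⟩ ?_
    · rintro ⟨l, rfl⟩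
      rfl
    · rintro ⟨l, rfl⟩
      rfl
  · refine (gf_congr ⟨fun m => ⟨some m, by simp⟩, fun o => o.1.get (Option.ne_none_iff_isSome.1 o.2),
      fun _ => rfl, fun o => Subtype.ext (Option.some_get _)⟩ fun m => ?_).symm
    simp [optionWeight]

lemma gf_palindromic : gf (fun c : {c : Code // c.rev = c} => c.1.weight) =
    gf (fun m : {m : Multiset ℕ // 2 ≤ m.card} => 2 • weight m) *
      (gf (listWeight fun m => 2 • weight m) *
        (1 + gf (fun m : Multiset ℕ => 1 • weight m))) := by
  rw [← gf_optionWeight, ← gf_prod (finiteFibers_listWeight two_pos) finiteFibers_optionWeight,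
    ← gf_prod (finiteFibers_fork two_pos)
      ((finiteFibers_listWeight two_pos).prod finiteFibers_optionWeight)]
  exact (gf_congr (Equiv.ofBijective _ palindromicCode_bijective)
    weight_palindromicCode).symm

lemma one_le_weight_zero_and_two_le_weight_one (c : Code) : 1 ≤ c.weight 0 ∧ 2 ≤ c.weight 1 := by
  have h : ∀ m : {m : Multiset ℕ // 2 ≤ m.card}, weight m 1 = 1 := by
    intro m
    rw [weight_apply_one, if_neg]
    intro h0
    have := m.2
    rw [h0] at this
    simp at this
  rw [Code.weight_eq]
  simp only [Finsupp.add_apply, weight_apply_zero, h]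
  lia

/-- Counting codes up to reversal. -/
theorem two_mul_linearTreeGF : 2 * linearTreeGF =
    gf Code.weight + gf (fun c : {c : Code // c.rev = c} => c.1.weight) := by
  ext e
  have hfin := finiteFibers_code e
  have h2 : (2 : MvPowerSeries (Fin 2) ℚ) = C 2 := (map_ofNat C 2).symm
  have hcoeff : coeff e linearTreeGF =
      if 1 ≤ e 0 ∧ 2 ≤ e 1 then (numKLinearTrees (e 0) (e 1) : ℚ) else 0 := rfl
  rw [h2, coeff_C_mul, hcoeff, map_add, coeff_gf, coeff_gf]
  have hpal : Nat.card {c : {c : Code // c.rev = c} // c.1.weight = e} =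
      Nat.card {c : Code // c.rev = c ∧ c.weight = e} :=
    Nat.card_congr (Equiv.subtypeSubtypeEquivSubtypeInter _ (fun c : Code => c.weight = e))
  rw [hpal]
  split_ifs with he
  · exact_mod_cast two_mul_numKLinearTrees e he.2
  · have h1 : IsEmpty {c : Code // c.weight = e} :=
      ⟨fun c => he (c.2 ▸ one_le_weight_zero_and_two_le_weight_one c.1)⟩
    have h3 : IsEmpty {c : Code // c.rev = c ∧ c.weight = e} :=
      ⟨fun c => he (c.2.2 ▸ one_le_weight_zero_and_two_le_weight_one c.1)⟩
    simp

end main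
end LinearTrees

theorem theorem1 (x y Px Px2 : MvPowerSeries (Fin 2) ℚ)
    (hx : x = MvPowerSeries.X 0) (hy : y = MvPowerSeries.X 1)
    (hPx : Px = LinearTrees.partitionGF.subst x)
    (hPx2 : Px2 = LinearTrees.partitionGF.subst (x ^ 2)) :
    2 * LinearTrees.linearTreeGF =
      (Px - (1 - x)⁻¹) ^ 2 * (x ^ 2 * y ^ 2 * (1 - x + x * y - x * y * Px)⁻¹)
      + (1 - x)⁻¹ * (Px2 - (1 - x ^ 2)⁻¹) *
          (x ^ 2 * y ^ 2 * (1 - (Px2 - 1) * x ^ 2 * y ^ 2 * (1 - x ^ 2)⁻¹)⁻¹)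
      + (Px2 - (1 - x ^ 2)⁻¹) * ((Px - 1) * (1 - x ^ 2)⁻¹) *
          (x ^ 3 * y ^ 3 * (1 - (Px2 - 1) * x ^ 2 * y ^ 2 * (1 - x ^ 2)⁻¹)⁻¹) := by
  have hA₁ := LinearTrees.gf_fork one_pos
  have hA₂ := LinearTrees.gf_fork two_pos
  have hB₁ := LinearTrees.gf_smul_weight one_pos
  have hL₁ := LinearTrees.gf_list (LinearTrees.finiteFibers_smul_weight one_pos)
    (LinearTrees.smul_weight_pos one_pos)
  have hL₂ := LinearTrees.gf_list (LinearTrees.finiteFibers_smul_weight two_pos)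
    (LinearTrees.smul_weight_pos two_pos)
  rw [hB₁] at hL₁
  rw [LinearTrees.gf_smul_weight two_pos] at hL₂
  rw [LinearTrees.two_mul_linearTreeGF, LinearTrees.gf_code, LinearTrees.gf_palindromic, hA₁, hA₂,
    hB₁]
  simp only [pow_one] at hL₁ hL₂ ⊢
  rw [← hx, ← hy, ← hPx] at hL₁
  rw [← hx, ← hy, ← hPx2] at hL₂
  rw [← hx, ← hy, ← hPx, ← hPx2]
  generalize LinearTrees.gf (LinearTrees.listWeight _) = L₁ at hL₁ ⊢
  generalize LinearTrees.gf (LinearTrees.listWeight _) = L₂ at hL₂ ⊢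
  have hx0 : MvPowerSeries.constantCoeff x = 0 := by rw [hx]; simp
  have hI₁ : (1 - x)⁻¹ * (1 - x) = 1 := MvPowerSeries.inv_mul_cancel _ (by simp [hx0])
  have hI₂ : (1 - x ^ 2)⁻¹ * (1 - x ^ 2) = 1 := MvPowerSeries.inv_mul_cancel _ (by simp [hx0])
  -- `L₁` and `L₂` count the lists of inner vertices, the latter with all weights doubled
  have hD : (1 - x + x * y - x * y * Px)⁻¹ = L₁ := by
    symm
    rw [MvPowerSeries.eq_inv_iff_mul_eq_one (by simp [hx0])]
    linear_combination hL₁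
  have hE : (1 - (Px2 - 1) * x ^ 2 * y ^ 2 * (1 - x ^ 2)⁻¹)⁻¹ = L₂ * (1 - x ^ 2) := by
    symm
    rw [MvPowerSeries.eq_inv_iff_mul_eq_one (by simp [hx0])]
    linear_combination hL₂ - L₂ * (Px2 - 1) * x ^ 2 * y ^ 2 * hI₂
  rw [hD, hE]
  generalize (1 - x)⁻¹ = I₁ at hI₁ ⊢
  generalize (1 - x ^ 2)⁻¹ = I₂ at hI₂ ⊢
  linear_combination (-(Px2 - I₂) * x ^ 2 * y ^ 2 * L₂ * (1 + x)) * hI₁ -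
    (Px2 - I₂) * (Px - 1) * x ^ 3 * y ^ 3 * L₂ * hI₂
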